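/- Let $\Bbbk$ be a commutative ring, $R$ a $\Bbbk$-linear category, $G$ a group, and $A\colon G\to\operatorname{Aut}(R)$ a homomorphism to the group of (strict) $\Bbbk$-linear automorphisms of $R$; write $\alpha x=A_\alpha x$, $\alpha f=A_\alpha f$. *Orbit category.* $R/G$ has the objects of $R$; a morphism $x\to y$ is a row finite and column finite matrix $f=(f_{\beta,\alpha})_{\alpha,\beta\in G}$ of morphisms $f_{\beta,\alpha}\in R(\alpha x,\beta y)$ with $f_{\gamma\beta,\gamma\alpha}=\gamma(f_{\beta,\alpha})$ for all $\alpha,\beta,\gamma\in G$; composition is the matrix product. *Modules and complexes.* $\operatorname{Mod}R$ is the category of contravariant $\Bbbk$-linear functors from $R$ to $\Bbbk$-modules. A module is finitely generated if it receives an epimorphism from a finite direct sum of representable functors $R(-,x)$. $\mathcal K(\operatorname{Prj}R)$ is the homotopy category of cochain complexes of projective $R$-modules, and $\mathcal K^{\mathrm b}(\operatorname{prj}R)$ is its full subcategory of bounded complexes of finitely generated projective modules; likewise for $R/G$. The group $G$ acts on $\operatorname{Mod}R$ by ${}^{\alpha}X:=X\circ A_{\alpha^{-1}}$, and degreewise on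 $\mathcal K^{\mathrm b}(\operatorname{prj}R)$. *Pushdown.* Let $P_\bullet\colon\operatorname{Mod}R\to\operatorname{Mod}R/G$ be given by $(P_\bullet X)(x)=\bigoplus_{\alpha\in G}X(\alpha x)$, by $(P_\bullet X)(f)=(X(f_{\beta,\alpha}))_{\beta,\alpha}\colon\bigoplus_{\beta}X(\beta y)\to\bigoplus_{\alpha}X(\alpha x)$ for $f\colon x\to y$ in $R/G$, and by $(P_\bullet u)_x=\bigoplus_\alpha u_{\alpha x}$ for $u\colon X\to X'$ (it is left adjoint to composition with the canonical functor $P\colon R\to R/G$, $P(x)=x$, $P(f)=(\delta_{\alpha,\beta}\,\alpha f)_{\alpha,\beta}$). For $\mu\in G$ let $\phi_\mu\colon P_\bullet\to P_\bullet\circ{}^{\mu}(-)$ have the components $(\delta_{\alpha,\mu^{-1}\beta}\,\mathrm{id}_{X(\alpha x)})_{\alpha,\beta}\colon\bigoplus_{\alpha}X(\alpha x)\to\bigoplus_{\beta}X(\mu^{-1}\beta x)$. Applied degreewise, these define a functor $P_\bullet\colon\mathcal K^{\mathrm b}(\operatorname{prj}R)\to\mathcal K^{\mathrm b}(\operatorname{prj}R/G)$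 and natural transformations $\phi_\mu\colon P_\bullet\to P_\bullet\circ{}^{\mu}(-)$. **Theorem.** The pushdown functor $(P_\bullet,\phi)\colon\mathcal K^{\mathrm b}(\operatorname{prj}R)\to\mathcal K^{\mathrm b}(\operatorname{prj}R/G)$ is a $G$-precovering. That is: 1. $\phi=(\phi_\mu)_{\mu\in G}$ is an invariance adjuster of $P_\bullet$: every $\phi_\mu$ is a natural isomorphism, $\phi_1=\mathrm{id}$, and $\phi_{\beta\alpha,X}=\phi_{\beta,{}^{\alpha}X}\circ\phi_{\alpha,X}$ for all $\alpha,\beta\in G$ and all $X$; 2. for all $X,Y\in\mathcal K^{\mathrm b}(\operatorname{prj}R)$ the $\Bbbk$-linear map $$\bigoplus_{\alpha\in G}\mathcal K^{\mathrm b}(\operatorname{prj}R)({}^{\alpha}X,Y)\to\mathcal K^{\mathrm b}(\operatorname{prj}R/G)(P_\bullet X,P_\bullet Y),\qquad (f_\alpha)_\alpha\mapsto\sum_{\alpha\in G}P_\bullet(f_\alpha)\circ\phi_{\alpha,X}$$ is an isomorphism. -/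

import Mathlib

open CategoryTheory CategoryTheory.Limits Opposite

universe t t' uk u v w u' v'

namespace Covering

/-- A `k`-linear category with a `G`-action: a group homomorphism from `G` to the group of
(strict) automorphisms of the `k`-linear category `C`.  (Each `act α` is automatically an
automorphism with inverse `act α⁻¹`.) -/
structure GAction (k : Type uk) [CommRing k] (G : Type w) [Group G]
    (C : Type u) [Category.{v} C] [Preadditive C] [Linear k C] where
  act : G → (C ⥤ C)
  additive : ∀ α, (act α).Additive
  linear : ∀ α, (act α).Linear k
  act_one : act 1 = 𝟭 C
  act_mul : ∀ β α, act (β * α) = act α ⋙ act β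

attribute [instance] GAction.additive GAction.linear

section GCat

variable {k : Type uk} [CommRing k] {G : Type w} [Group G]
  {C : Type u} [Category.{v} C] [Preadditive C] [Linear k C]

namespace GAction

variable (A : GAction k G C)

/-- The object `α x`. -/
abbrev o (α : G) (x : C) : C := (A.act α).obj x

theorem o_one (x : C) : A.o 1 x = x := by
  simp [o, A.act_one]

theorem o_mul (β α : G) (x : C) : A.o (β * α) x = A.o β (A.o α x) := by
  simp [o, A.act_mul]

theorem o_inv_o (α : G) (x : C) : A.o α⁻¹ (A.o α x) = x := by
  rw [← A.o_mul, inv_mul_cancel, A.o_one]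

theorem o_o_inv (α : G) (x : C) : A.o α (A.o α⁻¹ x) = x := by
  rw [← A.o_mul, mul_inv_cancel, A.o_one]

theorem map_one {x y : C} (f : x ⟶ y) :
    (A.act 1).map f = eqToHom (A.o_one x) ≫ f ≫ eqToHom (A.o_one y).symm := by
  simpa using Functor.congr_hom A.act_one f

theorem map_mul (β α : G) {x y : C} (f : x ⟶ y) :
    (A.act (β * α)).map f =
      eqToHom (A.o_mul β α x) ≫ (A.act β).map ((A.act α).map f) ≫
        eqToHom (A.o_mul β α y).symm := by
  simpa using Functor.congr_hom (A.act_mul β α) f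

theorem map_eq {α β : G} (h : α = β) {x y : C} (f : x ⟶ y) :
    (A.act α).map f = eqToHom (by rw [h]) ≫ (A.act β).map f ≫ eqToHom (by rw [h]) := by
  subst h; simp

end GAction

section Precovering

variable (A : GAction k G C) {D : Type u'} [Category.{v'} D] [Preadditive D] [Linear k D]

/-- `φ = (φ_α : F ⟶ F A_α)_α` is an invariance adjuster of `F`: every `φ_α` is a natural
isomorphism, `φ_1 = id_F` and `φ_{βα} = (φ_β A_α) ∘ φ_α`.  The `eqToHom`s are the identities
`F (1 x) = F x` and `F ((βα) x) = F (β (α x))`. -/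
structure IsInvarianceAdjuster (F : C ⥤ D) (φ : ∀ α : G, F ⟶ A.act α ⋙ F) : Prop where
  isIso : ∀ α, IsIso (φ α)
  one : ∀ x : C, (φ 1).app x ≫ F.map (eqToHom (A.o_one x)) = 𝟙 (F.obj x)
  mul : ∀ (β α : G) (x : C),
    (φ (β * α)).app x ≫ F.map (eqToHom (A.o_mul β α x)) =
      (φ α).app x ≫ (φ β).app (A.o α x)

open scoped Classical in
/-- The map `F⁽¹⁾_{x,y} : ⨁_α C(α x, y) → D(F x, F y)`, `(f_α)_α ↦ ∑_α F(f_α) ∘ φ_{α,x}`. -/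
noncomputable def precoveringMap (F : C ⥤ D) [F.Additive] [F.Linear k]
    (φ : ∀ α : G, F ⟶ A.act α ⋙ F) (x y : C) :
    (DirectSum G fun α => (A.o α x ⟶ y)) →ₗ[k] (F.obj x ⟶ F.obj y) :=
  DirectSum.toModule k G _ fun α =>
    Linear.leftComp k (F.obj y) ((φ α).app x) ∘ₗ F.mapLinearMap k

/-- `(F, φ)` is a `G`-precovering: `φ` is an invariance adjuster of the `k`-linear functor `F`, and
all the maps `F⁽¹⁾_{x,y}` are isomorphisms. -/
structure IsGPrecovering (F : C ⥤ D) [F.Additive] [F.Linear k]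
    (φ : ∀ α : G, F ⟶ A.act α ⋙ F) : Prop where
  adjuster : IsInvarianceAdjuster A F φ
  bijective : ∀ x y : C, Function.Bijective (precoveringMap A F φ x y)

end Precovering

/-! ### The orbit category -/

section Orbit

variable (A : GAction k G C)

/-- The Hom-modules of the orbit category: row and column finite matrices `(f_{β,α})` of morphisms
`f_{β,α} : α x ⟶ β y` (written `f α β` below) with `f_{γβ,γα} = γ(f_{β,α})`.  The `eqToHom`s are the
identities `(γα) x = γ (α x)` and `(γβ) y = γ (β y)`. -/
def orbitHom (x y : C) : Submodule k (∀ α β : G, A.o α x ⟶ A.o β y) where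
  carrier := { f |
    (∀ α, {β | f α β ≠ 0}.Finite) ∧ (∀ β, {α | f α β ≠ 0}.Finite) ∧
    ∀ γ α β, f (γ * α) (γ * β) =
      eqToHom (A.o_mul γ α x) ≫ (A.act γ).map (f α β) ≫ eqToHom (A.o_mul γ β y).symm }
  zero_mem' := by simp
  add_mem' := by
    rintro f g ⟨hf1, hf2, hf3⟩ ⟨hg1, hg2, hg3⟩
    refine ⟨fun α => ((hf1 α).union (hg1 α)).subset ?_, fun β => ((hf2 β).union (hg2 β)).subset ?_,
      fun γ α β => ?_⟩
    · intro β hβ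
      by_contra h
      simp only [Set.mem_union, Set.mem_ofPred_eq, not_or, not_not] at h
      exact hβ (by simp [h.1, h.2])
    · intro β hβ
      by_contra h
      simp only [Set.mem_union, Set.mem_ofPred_eq, not_or, not_not] at h
      exact hβ (by simp [h.1, h.2])
    · simp [hf3, hg3]
  smul_mem' := by
    rintro r f ⟨hf1, hf2, hf3⟩
    refine ⟨fun α => (hf1 α).subset ?_, fun β => (hf2 β).subset ?_, fun γ α β => ?_⟩
    · intro β hβ h0
      exact hβ (by simp [h0])
    · intro β hβ h0
      exact hβ (by simp [h0])
    · simp [hf3]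

/-- Matrix product; the sum is finite. -/
noncomputable def orbitComp {x y z : C} (f : ∀ α β : G, A.o α x ⟶ A.o β y)
    (g : ∀ α β : G, A.o α y ⟶ A.o β z) (α β : G) : A.o α x ⟶ A.o β z :=
  ∑ᶠ γ, f α γ ≫ g γ β

variable {A}

theorem orbitComp_eq_left {x y z : C} (f : ∀ α β : G, A.o α x ⟶ A.o β y)
    (g : ∀ α β : G, A.o α y ⟶ A.o β z) (α β : G) (S : Finset G) (hS : ∀ γ, f α γ ≠ 0 → γ ∈ S) :
    orbitComp A f g α β = ∑ γ ∈ S, f α γ ≫ g γ β := by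
  refine finsum_eq_sum_of_support_subset _ fun γ hγ => hS γ fun h => hγ ?_
  simp [h]

theorem orbitComp_eq_right {x y z : C} (f : ∀ α β : G, A.o α x ⟶ A.o β y)
    (g : ∀ α β : G, A.o α y ⟶ A.o β z) (α β : G) (S : Finset G) (hS : ∀ γ, g γ β ≠ 0 → γ ∈ S) :
    orbitComp A f g α β = ∑ γ ∈ S, f α γ ≫ g γ β := by
  refine finsum_eq_sum_of_support_subset _ fun γ hγ => hS γ fun h => hγ ?_
  simp [h]

theorem orbitComp_single {x y z : C} (f : ∀ α β : G, A.o α x ⟶ A.o β y)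
    (g : ∀ α β : G, A.o α y ⟶ A.o β z) (α β γ : G)
    (h : ∀ γ', γ' ≠ γ → f α γ' = 0 ∨ g γ' β = 0) :
    orbitComp A f g α β = f α γ ≫ g γ β := by
  refine finsum_eq_single _ γ fun γ' hγ' => ?_
  rcases h γ' hγ' with h | h <;> simp [h]

theorem orbitComp_mem {x y z : C} (f : orbitHom A x y) (g : orbitHom A y z) :
    orbitComp A f.1 g.1 ∈ orbitHom A x z := by
  classical
  obtain ⟨f, hf1, hf2, hf3⟩ := f
  obtain ⟨g, hg1, hg2, hg3⟩ := g
  refine ⟨fun α => ?_, fun β => ?_, fun γ α β => ?_⟩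
  · refine ((hf1 α).biUnion (fun γ _ => hg1 γ)).subset fun β hβ => ?_
    by_contra h
    simp only [Set.mem_iUnion, not_exists] at h
    refine hβ (finsum_eq_zero_of_forall_eq_zero fun γ => ?_)
    by_cases h1 : f α γ = 0
    · simp [h1]
    · have := h γ h1
      simp only [Set.mem_ofPred_eq, not_not] at this
      simp [this]
  · refine ((hg2 β).biUnion (fun γ _ => hf2 γ)).subset fun α hα => ?_
    by_contra h
    simp only [Set.mem_iUnion, not_exists] at h
    refine hα (finsum_eq_zero_of_forall_eq_zero fun γ => ?_)
    by_cases h1 : g γ β = 0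
    · simp [h1]
    · have := h γ h1
      simp only [Set.mem_ofPred_eq, not_not] at this
      simp [this]
  · have key : ∀ δ, f (γ * α) (γ * δ) ≫ g (γ * δ) (γ * β) =
        eqToHom (A.o_mul γ α x) ≫ (A.act γ).map (f α δ ≫ g δ β) ≫
          eqToHom (A.o_mul γ β z).symm := by
      intro δ; simp [hf3, hg3]
    rw [orbitComp_eq_left f g α β (hf1 α).toFinset (by simp),
      orbitComp_eq_left f g (γ * α) (γ * β) ((hf1 α).toFinset.image (γ * ·)) ?_]
    · rw [Finset.sum_image (by intro a _ b _ h; exact mul_left_cancel h)]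
      simp only [key]
      simp only [Functor.map_sum, Preadditive.comp_sum, Preadditive.sum_comp]
    · intro δ hδ
      obtain ⟨δ, rfl⟩ : ∃ δ', δ = γ * δ' := ⟨γ⁻¹ * δ, by simp⟩
      simp only [Finset.mem_image, Set.Finite.mem_toFinset, Set.mem_ofPred_eq]
      refine ⟨δ, fun h => hδ ?_, rfl⟩
      simp [hf3, h]

open scoped Classical in
/-- The identity matrix. -/
noncomputable def orbitId (A : GAction k G C) (x : C) (α β : G) : A.o α x ⟶ A.o β x :=
  if h : α = β then eqToHom (by rw [h]) else 0

theorem orbitId_mem (A : GAction k G C) (x : C) : orbitId A x ∈ orbitHom A x x := by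
  classical
  refine ⟨fun α => (Set.finite_singleton α).subset fun β hβ => ?_,
    fun α => (Set.finite_singleton α).subset fun β hβ => ?_, fun γ α β => ?_⟩
  · by_contra h
    exact hβ (dif_neg fun h' => h h'.symm)
  · by_contra h
    exact hβ (dif_neg fun h' => h h')
  · by_cases h : α = β
    · subst h; simp [orbitId]
    · simp [orbitId, h]

theorem orbitId_comp {x y : C} (f : ∀ α β : G, A.o α x ⟶ A.o β y) :
    orbitComp A (orbitId A x) f = f := by
  funext α β
  rw [orbitComp_single _ _ α β α]
  · simp [orbitId]
  · intro γ h; left; simp [orbitId, h.symm]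

theorem orbitComp_id {x y : C} (f : ∀ α β : G, A.o α x ⟶ A.o β y) :
    orbitComp A f (orbitId A y) = f := by
  funext α β
  rw [orbitComp_single _ _ α β β]
  · simp [orbitId]
  · intro γ h; right; simp [orbitId, h]

theorem orbitComp_assoc {x y z t : C} (f : orbitHom A x y) (g : orbitHom A y z)
    (h : orbitHom A z t) :
    orbitComp A (orbitComp A f.1 g.1) h.1 = orbitComp A f.1 (orbitComp A g.1 h.1) := by
  funext α β
  rw [orbitComp_eq_left f.1 _ α β (f.2.1 α).toFinset (by simp),
    orbitComp_eq_right _ h.1 α β (h.2.2.1 β).toFinset (by simp)]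
  have h1 : ∀ γ, orbitComp A f.1 g.1 α γ =
      ∑ δ ∈ (f.2.1 α).toFinset, f.1 α δ ≫ g.1 δ γ := fun γ =>
    orbitComp_eq_left f.1 g.1 α γ (f.2.1 α).toFinset (by simp)
  have h2 : ∀ δ, orbitComp A g.1 h.1 δ β =
      ∑ γ ∈ (h.2.2.1 β).toFinset, g.1 δ γ ≫ h.1 γ β := fun δ =>
    orbitComp_eq_right g.1 h.1 δ β (h.2.2.1 β).toFinset (by simp)
  simp only [h1, h2, Preadditive.comp_sum, Preadditive.sum_comp, Category.assoc]
  exact Finset.sum_comm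

theorem orbitComp_add_left {x y z : C} (f f' : orbitHom A x y) (g : orbitHom A y z) :
    orbitComp A (f + f').1 g.1 = orbitComp A f.1 g.1 + orbitComp A f'.1 g.1 := by
  funext α β
  simp only [Pi.add_apply]
  simp only [fun f : orbitHom A x y => orbitComp_eq_right f.1 g.1 α β (g.2.2.1 β).toFinset (by simp),
    ← Finset.sum_add_distrib]
  refine Finset.sum_congr rfl fun γ _ => ?_
  exact Preadditive.add_comp _ _ _ _ _ _

theorem orbitComp_add_right {x y z : C} (f : orbitHom A x y) (g g' : orbitHom A y z) :
    orbitComp A f.1 (g + g').1 = orbitComp A f.1 g.1 + orbitComp A f.1 g'.1 := by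
  funext α β
  simp only [Pi.add_apply]
  simp only [fun g : orbitHom A y z => orbitComp_eq_left f.1 g.1 α β (f.2.1 α).toFinset (by simp),
    ← Finset.sum_add_distrib]
  refine Finset.sum_congr rfl fun γ _ => ?_
  exact Preadditive.comp_add _ _ _ _ _ _

theorem orbitComp_smul_left {x y z : C} (r : k) (f : orbitHom A x y) (g : orbitHom A y z) :
    orbitComp A (r • f).1 g.1 = r • orbitComp A f.1 g.1 := by
  funext α β
  simp only [Pi.smul_apply]
  simp only [fun f : orbitHom A x y => orbitComp_eq_right f.1 g.1 α β (g.2.2.1 β).toFinset (by simp),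
    Finset.smul_sum]
  refine Finset.sum_congr rfl fun γ _ => ?_
  exact Linear.smul_comp _ _ _ _ _ _

theorem orbitComp_smul_right {x y z : C} (r : k) (f : orbitHom A x y) (g : orbitHom A y z) :
    orbitComp A f.1 (r • g).1 = r • orbitComp A f.1 g.1 := by
  funext α β
  simp only [Pi.smul_apply]
  simp only [fun g : orbitHom A y z => orbitComp_eq_left f.1 g.1 α β (f.2.1 α).toFinset (by simp),
    Finset.smul_sum]
  refine Finset.sum_congr rfl fun γ _ => ?_
  exact Linear.comp_smul _ _ _ _ _ _

/-- The orbit category `C/G`; its objects are those of `C`. -/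
structure Orbit (A : GAction k G C) where
  of ::
  base : C

noncomputable instance : Category.{max v w} (Orbit A) where
  Hom x y := orbitHom A x.base y.base
  id x := ⟨orbitId A x.base, orbitId_mem A x.base⟩
  comp f g := ⟨orbitComp A f.1 g.1, orbitComp_mem f g⟩
  id_comp f := Subtype.ext (orbitId_comp f.1)
  comp_id f := Subtype.ext (orbitComp_id f.1)
  assoc f g h := Subtype.ext (orbitComp_assoc f g h)

noncomputable instance : Preadditive (Orbit A) where
  homGroup x y := inferInstanceAs (AddCommGroup (orbitHom A x.base y.base))
  add_comp _ _ _ f f' g := Subtype.ext (orbitComp_add_left f f' g)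
  comp_add _ _ _ f g g' := Subtype.ext (orbitComp_add_right f g g')

noncomputable instance : Linear k (Orbit A) where
  homModule x y := inferInstanceAs (Module k (orbitHom A x.base y.base))
  smul_comp _ _ _ r f g := Subtype.ext (orbitComp_smul_left r f g)
  comp_smul _ _ _ f r g := Subtype.ext (orbitComp_smul_right r f g)

/-- The matrix entry `f_{β,α} : α x ⟶ β y` of a morphism of the orbit category. -/
def Orbit.entry {x y : Orbit A} (f : x ⟶ y) (α β : G) : A.o α x.base ⟶ A.o β y.base :=
  f.1 α β

end Orbit

end GCat

/-! ### Modules over a linear category -/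

section Modules

variable (k : Type uk) [CommRing k] (C : Type u) [Category.{v} C] [Preadditive C] [Linear k C]

/-- A contravariant functor to `k`-modules is `k`-linear. -/
def isLinearPresheaf : ObjectProperty (Cᵒᵖ ⥤ ModuleCat.{max v t} k) := fun X =>
  (∀ (x y : C) (f g : x ⟶ y), X.map (f + g).op = X.map f.op + X.map g.op) ∧
  ∀ (x y : C) (r : k) (f : x ⟶ y), X.map (r • f).op = r • X.map f.op

/-- `Mod C`: contravariant `k`-linear functors from `C` to `k`-modules. -/
abbrev Md := (isLinearPresheaf.{t} k C).FullSubcategory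

variable {k C}

namespace Md

/-- The module `X(x)`. -/
abbrev ev (X : Md.{t} k C) (x : C) : ModuleCat.{max v t} k := X.obj.obj (op x)

/-- The map `X(f) : X(y) → X(x)` for `f : x ⟶ y`. -/
def res (X : Md.{t} k C) {x y : C} (f : x ⟶ y) : X.ev y →ₗ[k] X.ev x := (X.obj.map f.op).hom

/-- The component at `x` of a morphism of modules. -/
def app {X Y : Md.{t} k C} (f : X ⟶ Y) (x : C) : X.ev x →ₗ[k] Y.ev x := (f.hom.app (op x)).hom

section
variable (X Y Z : Md.{t} k C) {x y z : C}

@[simp] theorem res_id (m : X.ev x) : X.res (𝟙 x) m = m := by simp [res]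
@[simp] theorem res_comp (f : x ⟶ y) (g : y ⟶ z) (m : X.ev z) :
    X.res (f ≫ g) m = X.res f (X.res g m) := by simp [res]
@[simp] theorem res_add (f g : x ⟶ y) (m : X.ev y) :
    X.res (f + g) m = X.res f m + X.res g m := by
  unfold res; rw [X.property.1]; rfl
@[simp] theorem res_smul (r : k) (f : x ⟶ y) (m : X.ev y) :
    X.res (r • f) m = r • X.res f m := by
  unfold res; rw [X.property.2]; rfl
@[simp] theorem res_zero (m : X.ev y) : X.res (0 : x ⟶ y) m = 0 := by
  have := X.res_smul (0 : k) (0 : x ⟶ y) m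
  rwa [zero_smul, zero_smul] at this
theorem res_sum {ι : Type*} (s : Finset ι) (f : ι → (x ⟶ y)) (m : X.ev y) :
    X.res (∑ i ∈ s, f i) m = ∑ i ∈ s, X.res (f i) m := by
  classical
  induction s using Finset.induction_on with
  | empty => simp
  | insert a s ha ih => simp [Finset.sum_insert ha, ih]

variable {X Y Z}
theorem app_res (f : X ⟶ Y) (g : x ⟶ y) (m : X.ev y) :
    app f x (X.res g m) = Y.res g (app f y m) := by
  simp [app, res]
@[simp] theorem app_id (m : X.ev x) : app (𝟙 X) x m = m := rfl
@[simp] theorem app_comp (f : X ⟶ Y) (g : Y ⟶ Z) (m : X.ev x) :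
    app (f ≫ g) x m = app g x (app f x m) := rfl
@[simp] theorem app_add (f g : X ⟶ Y) (m : X.ev x) :
    app (f + g) x m = app f x m + app g x m := rfl
@[simp] theorem app_zero (m : X.ev x) : app (0 : X ⟶ Y) x m = 0 := rfl
@[simp] theorem app_smul (r : k) (f : X ⟶ Y) (m : X.ev x) :
    app (r • f) x m = r • app f x m := rfl
theorem app_sum {ι : Type*} (s : Finset ι) (f : ι → (X ⟶ Y)) (m : X.ev x) :
    app (∑ i ∈ s, f i) x m = ∑ i ∈ s, app (f i) x m := by
  classical
  induction s using Finset.induction_on with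
  | empty => simp
  | insert a s ha ih => simp [Finset.sum_insert ha, ih]

theorem hom_ext' {f g : X ⟶ Y} (h : ∀ x (m : X.ev x), app f x m = app g x m) : f = g := by
  apply ObjectProperty.hom_ext
  ext x m
  exact h x.unop m
end

/-- Constructor for modules. -/
@[simps obj_obj]
def mk' (E : C → Type (max v t)) [∀ x, AddCommGroup (E x)] [∀ x, Module k (E x)]
    (r : ∀ {x y : C}, (x ⟶ y) → (E y →ₗ[k] E x))
    (hid : ∀ x, r (𝟙 x) = LinearMap.id)
    (hcomp : ∀ {x y z} (f : x ⟶ y) (g : y ⟶ z), r (f ≫ g) = r f ∘ₗ r g)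
    (hadd : ∀ {x y} (f g : x ⟶ y), r (f + g) = r f + r g)
    (hsmul : ∀ {x y} (a : k) (f : x ⟶ y), r (a • f) = a • r f) : Md.{t} k C where
  obj :=
    { obj x := ModuleCat.of k (E x.unop)
      map f := ModuleCat.ofHom (r f.unop)
      map_id x := by simp [hid]
      map_comp f g := by simp [hcomp] }
  property := ⟨fun x y f g => by simp [hadd], fun x y a f => by ext m; simp [hsmul]⟩

/-- Constructor for morphisms of modules. -/
def homMk' {X Y : Md.{t} k C} (f : ∀ x, X.ev x →ₗ[k] Y.ev x)
    (h : ∀ {x y : C} (g : x ⟶ y) (m : X.ev y), f x (X.res g m) = Y.res g (f y m)) : X ⟶ Y :=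
  ObjectProperty.homMk
    { app x := ModuleCat.ofHom (f x.unop)
      naturality x y g := by
        ext m
        exact h g.unop m }

@[simp] theorem app_homMk' {X Y : Md.{t} k C} (f : ∀ x, X.ev x →ₗ[k] Y.ev x) (h) (x : C) :
    app (homMk' (X := X) (Y := Y) f h) x = f x := rfl

/-- The representable module `C(-, x)`. -/
def rep (x : C) : Md.{t} k C where
  obj := (linearYoneda k C).obj x ⋙ ModuleCat.uliftFunctor.{t} k
  property := ⟨fun y z f g => by
      ext m
      apply ULift.ext
      exact Preadditive.add_comp _ _ _ _ _ _, fun y z r f => by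
      ext m
      apply ULift.ext
      exact Linear.smul_comp _ _ _ _ _ _⟩

theorem res_rep {x y z : C} (f : y ⟶ z) (m : (rep.{t} (k := k) x).ev z) :
    (rep.{t} (k := k) x).res f m = ULift.up (f ≫ ULift.down m) := rfl

/-- The morphism out of a representable module given by an element. -/
def fromRep (X : Md.{t} k C) (x : C) (m : X.ev x) : rep.{t} (k := k) x ⟶ X :=
  homMk' (fun y =>
    { toFun g := X.res (ULift.down g) m
      map_add' _ _ := X.res_add _ _ _
      map_smul' _ _ := X.res_smul _ _ _ })
    (fun g m => X.res_comp g (ULift.down m) _)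

@[simp] theorem app_fromRep (X : Md.{t} k C) (x : C) (m : X.ev x) (y : C)
    (g : (rep.{t} (k := k) x).ev y) :
    app (X.fromRep x m) y g = X.res (ULift.down g) m := rfl

/-- The direct sum of finitely many modules, computed pointwise. -/
def finSum {n : ℕ} (X : Fin n → Md.{t} k C) : Bicone X where
  pt := mk' (fun x => ∀ i, (X i).ev x)
    (fun f => LinearMap.pi fun i => (X i).res f ∘ₗ LinearMap.proj i)
    (fun x => by ext; simp) (fun f g => by ext; simp)
    (fun f g => by ext; simp) (fun a f => by ext; simp)
  π i := homMk' (fun x => LinearMap.proj i) (fun g m => rfl)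
  ι i := homMk' (fun x => LinearMap.single k (fun i => (X i).ev x) i) (fun {x y} g m => by
    funext j
    change (Pi.single i ((X i).res g m) : ∀ i, (X i).ev x) j =
      (X j).res g ((Pi.single i m : ∀ i, (X i).ev y) j)
    by_cases h : j = i
    · subst h; simp
    · simp [Pi.single_eq_of_ne h])
  ι_π i j := by
    apply hom_ext'
    intro x m
    change (Pi.single i m : ∀ i, (X i).ev x) j = _
    split_ifs with h
    · subst h
      simp
    · rw [Pi.single_eq_of_ne (Ne.symm h)]
      rfl

instance : HasFiniteBiproducts (Md.{t} k C) where
  out n := ⟨fun X => HasBiproduct.mk ⟨finSum X, isBilimitOfTotal _ (by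
    apply hom_ext'
    intro x m
    rw [app_sum]
    funext j
    exact congrFun (Finset.univ_sum_single (m : ∀ i, (X i).ev x)) j)⟩⟩

theorem surjective_of_epi {X Y : Md.{t} k C} (p : X ⟶ Y) [Epi p] (x : C) :
    Function.Surjective (app p x) := by
  let Q : Md.{t} k C := mk' (fun x => Y.ev x ⧸ LinearMap.range (app p x))
    (fun {x y} f => Submodule.mapQ _ _ (Y.res f) (by
      rintro _ ⟨m, rfl⟩
      exact ⟨X.res f m, app_res p f m⟩))
    (fun x => by ext; simp) (fun f g => by ext; simp)
    (fun f g => by ext; simp) (fun a f => by ext; simp)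
  let q : Y ⟶ Q := homMk' (fun x => Submodule.mkQ _) (fun g m => rfl)
  have hq : q = 0 := by
    rw [← cancel_epi p]
    apply hom_ext'
    intro x m
    change Submodule.Quotient.mk (app p x m) = (0 : Y.ev x ⧸ LinearMap.range (app p x))
    rw [Submodule.Quotient.mk_eq_zero]
    exact ⟨m, rfl⟩
  intro m
  have := congr(app $hq x m)
  change Submodule.Quotient.mk m = (0 : Y.ev x ⧸ LinearMap.range (app p x)) at this
  rw [Submodule.Quotient.mk_eq_zero] at this
  exact this

theorem epi_of_surjective {X Y : Md.{t} k C} (p : X ⟶ Y)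
    (h : ∀ x, Function.Surjective (app p x)) : Epi p where
  left_cancellation f g hfg := by
    apply hom_ext'
    intro x m
    obtain ⟨m, rfl⟩ := h x m
    exact congr(app $hfg x m)

end Md

/-- A finitely generated module: there is an epimorphism from a finite direct sum of
representable modules. -/
def Md.FG (X : Md.{t} k C) : Prop :=
  ∃ (n : ℕ) (x : Fin n → C) (p : (⨁ fun i => Md.rep.{t} (k := k) (x i)) ⟶ X), Epi p

variable (k C)

/-- `Prj C`: the projective modules. -/
abbrev Prj := (ObjectProperty.FullSubcategory fun X : Md.{t} k C => Projective X)

/-- The homotopy category `K(Prj C)` of cochain complexes. -/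
abbrev KPrj := HomotopyCategory (Prj.{t} k C) (ComplexShape.up ℤ)

/-- The bounded complexes of finitely generated projective modules. -/
def isBoundedFG : ObjectProperty (KPrj.{t} k C) := fun X =>
  (∀ i : ℤ, (X.as.X i).obj.FG) ∧ ∃ a b : ℤ, ∀ i : ℤ, i < a ∨ b < i → IsZero (X.as.X i)

/-- `K^b(prj C)`: the full subcategory of `K(Prj C)` of bounded complexes of finitely generated
projective modules. -/
abbrev Kb := (isBoundedFG.{t} k C).FullSubcategory

end Modules

section Induce

/-! ### Passing from module categories to homotopy categories -/

variable {k : Type uk} [CommRing k] {C : Type u} [Category.{v} C] [Preadditive C] [Linear k C]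
  {D : Type u'} [Category.{v'} D] [Preadditive D] [Linear k D]

open Md

theorem fg_of_functor (T : Md.{t} k C ⥤ Md.{t'} k D) [T.Additive]
    (hepi : ∀ {X Y : Md.{t} k C} (p : X ⟶ Y) [Epi p], Epi (T.map p))
    (hrep : ∀ x : C, ∃ (y : D) (q : rep.{t'} (k := k) y ⟶ T.obj (rep.{t} (k := k) x)), Epi q)
    (X : Md.{t} k C) (hX : X.FG) : (T.obj X).FG := by
  obtain ⟨n, x, p, hp⟩ := hX
  choose y q hq using hrep
  refine ⟨n, fun i => y (x i), biproduct.desc fun i => q (x i) ≫ T.map (biproduct.ι (fun i => rep.{t} (k := k) (x i)) i ≫ p),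
    ⟨fun f g h => ?_⟩⟩
  have := hepi p
  rw [← cancel_epi (T.map p)]
  have h1 : ∀ i, T.map (biproduct.ι (fun i => rep (x i)) i) ≫ T.map p ≫ f =
      T.map (biproduct.ι (fun i => rep (x i)) i) ≫ T.map p ≫ g := by
    intro i
    have := hq (x i)
    rw [← cancel_epi (q (x i))]
    have := congr(biproduct.ι (fun i => rep.{t'} (k := k) (y (x i))) i ≫ $h)
    simpa using this
  have h2 : 𝟙 (T.obj (⨁ fun i => rep (x i))) = ∑ i, T.map (biproduct.π (fun i => rep (x i)) i) ≫
      T.map (biproduct.ι (fun i => rep (x i)) i) := by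
    rw [← T.map_id, ← biproduct.total, Functor.map_sum]
    simp only [Functor.map_comp]
  rw [← Category.id_comp (T.map p ≫ f), ← Category.id_comp (T.map p ≫ g), h2]
  simp only [Preadditive.sum_comp, Category.assoc, h1]

end Induce

section Pushdown

variable {k : Type uk} [CommRing k] {G : Type w} [Group G]
  {C : Type u} [Category.{v} C] [Preadditive C] [Linear k C] (A : GAction k G C)

open Md

/-! ### The `G`-action on modules -/

/-- Precomposition of modules with a `k`-linear functor. -/
def precomp (T : C ⥤ C) [T.Additive] [T.Linear k] : Md.{t} k C ⥤ Md.{t} k C where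
  obj X :=
    { obj := T.op ⋙ X.obj
      property := ⟨fun x y f g => by simpa using X.property.1 _ _ (T.map f) (T.map g),
        fun x y r f => by simpa using X.property.2 _ _ r (T.map f)⟩ }
  map f := ObjectProperty.homMk (Functor.whiskerLeft T.op f.hom)

theorem precomp_id (T : C ⥤ C) [T.Additive] [T.Linear k] (h : T = 𝟭 C) :
    precomp.{t} (k := k) T = 𝟭 _ := by
  subst h; rfl

theorem precomp_comp (T S U : C ⥤ C) [T.Additive] [T.Linear k] [S.Additive] [S.Linear k]
    [U.Additive] [U.Linear k] (h : T = S ⋙ U) :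
    precomp.{t} (k := k) T = precomp U ⋙ precomp S := by
  subst h; rfl

instance (T : C ⥤ C) [T.Additive] [T.Linear k] : (precomp.{t} (k := k) T).Additive where
instance (T : C ⥤ C) [T.Additive] [T.Linear k] : (precomp.{t} (k := k) T).Linear k where

/-- The `G`-action on `Mod C`: `ᵅX = X ∘ A_{α⁻¹}`. -/
def actMd : GAction k G (Md.{t} k C) where
  act α := precomp (A.act α⁻¹)
  additive _ := inferInstance
  linear _ := inferInstance
  act_one := precomp_id _ (by rw [inv_one, A.act_one])
  act_mul β α := precomp_comp _ _ _ (by rw [mul_inv_rev, A.act_mul])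

theorem actMd_res (α : G) (X : Md.{t} k C) {x y : C} (f : x ⟶ y) :
    (((actMd.{t} A).act α).obj X).res f = X.res ((A.act α⁻¹).map f) := rfl

theorem actMd_app (α : G) {X Y : Md.{t} k C} (f : X ⟶ Y) (x : C) :
    app (((actMd.{t} A).act α).map f) x = app f (A.o α⁻¹ x) := rfl

theorem GAction.map_projective {D : Type u'} [Category.{v'} D] [Preadditive D] [Linear k D]
    (B : GAction k G D) (α : G) (X : D) (hX : Projective X) :
    Projective ((B.act α).obj X) := by
  let e : D ≌ D := CategoryTheory.Equivalence.mk (B.act α) (B.act α⁻¹)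
    (eqToIso (by rw [← B.act_mul, inv_mul_cancel, B.act_one]))
    (eqToIso (by rw [← B.act_mul, mul_inv_cancel, B.act_one]))
  exact (e.map_projective_iff X).2 hX

theorem actMd_fg (α : G) (X : Md.{t} k C) (hX : X.FG) : (((actMd.{t} A).act α).obj X).FG := by
  refine fg_of_functor _ ?_ ?_ X hX
  · intro X Y p _
    exact epi_of_surjective _ fun x => surjective_of_epi p _
  · intro x
    refine ⟨A.o α x, fromRep _ _ (ULift.up
      (eqToHom (A.o_inv_o α x))),
      epi_of_surjective _ fun y g => ?_⟩
    obtain ⟨g⟩ := g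
    change A.o α⁻¹ y ⟶ x at g
    refine ⟨ULift.up (eqToHom (A.o_o_inv α y).symm ≫ (A.act α).map g), ?_⟩
    apply ULift.ext
    change (A.act α⁻¹).map (_ ≫ (A.act α).map g) ≫ eqToHom
      (A.o_inv_o α x) = g
    have h := A.map_mul α⁻¹ α g
    rw [A.map_eq (inv_mul_cancel α), A.map_one] at h
    simp only [Category.assoc, eqToHom_trans, eqToHom_trans_assoc] at h
    have h' : (A.act α⁻¹).map ((A.act α).map g) =
      eqToHom (A.o_inv_o α _) ≫ g ≫ eqToHom (A.o_inv_o α x).symm := by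
      rw [← cancel_epi (eqToHom (A.o_mul α⁻¹ α _)), ← cancel_mono (eqToHom (A.o_mul α⁻¹ α _).symm)]
      simp only [Category.assoc, eqToHom_trans, eqToHom_trans_assoc]
      exact h.symm
    rw [Functor.map_comp, h', eqToHom_map]
    simp

/-! ### The canonical functor and the pullup -/

section
variable {A}

theorem Orbit.hom_ext {x y : Orbit A} {f g : x ⟶ y}
    (h : ∀ α β, Orbit.entry f α β = Orbit.entry g α β) : f = g :=
  Subtype.ext (funext fun α => funext fun β => h α β)

@[simp] theorem Orbit.entry_add {x y : Orbit A} (f g : x ⟶ y) (α β : G) :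
    Orbit.entry (f + g) α β = Orbit.entry f α β + Orbit.entry g α β := rfl

@[simp] theorem Orbit.entry_smul {x y : Orbit A} (r : k) (f : x ⟶ y) (α β : G) :
    Orbit.entry (r • f) α β = r • Orbit.entry f α β := rfl

@[simp] theorem Orbit.entry_zero {x y : Orbit A} (α β : G) :
    Orbit.entry (0 : x ⟶ y) α β = 0 := rfl

theorem Orbit.entry_sum {x y : Orbit A} {ι : Type*} (s : Finset ι) (f : ι → (x ⟶ y)) (α β : G) :
    Orbit.entry (∑ i ∈ s, f i) α β = ∑ i ∈ s, Orbit.entry (f i) α β := by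
  classical
  induction s using Finset.induction_on with
  | empty => simp
  | insert a s ha ih => simp [Finset.sum_insert ha, ih]

theorem Orbit.entry_id (x : Orbit A) (α β : G) : Orbit.entry (𝟙 x) α β = orbitId A x.base α β := rfl

theorem Orbit.entry_comp {x y z : Orbit A} (f : x ⟶ y) (g : y ⟶ z) (α β : G) :
    Orbit.entry (f ≫ g) α β = orbitComp A (Orbit.entry f) (Orbit.entry g) α β := rfl

theorem Orbit.finite_col {x y : Orbit A} (f : x ⟶ y) (β : G) :
    {α | Orbit.entry f α β ≠ 0}.Finite := f.2.2.1 β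

theorem Orbit.entry_mul {x y : Orbit A} (f : x ⟶ y) (γ α β : G) :
    Orbit.entry f (γ * α) (γ * β) =
      eqToHom (A.o_mul γ α x.base) ≫ (A.act γ).map (Orbit.entry f α β) ≫
        eqToHom (A.o_mul γ β y.base).symm := f.2.2.2 γ α β

end

open scoped Classical in
/-- The morphism `P(f) = (δ_{α,β} αf) : x ⟶ y` of `C/G`. -/
noncomputable def canonicalMap {x y : C} (f : x ⟶ y) : Orbit.of (A := A) x ⟶ Orbit.of y :=
  ⟨fun α β => if h : α = β then (A.act α).map f ≫ eqToHom (by rw [h]) else 0, by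
    refine ⟨fun α => (Set.finite_singleton α).subset fun β hβ => ?_,
      fun α => (Set.finite_singleton α).subset fun β hβ => ?_, fun γ α β => ?_⟩
    · by_contra h
      exact hβ (dif_neg fun h' => h h'.symm)
    · by_contra h
      exact hβ (dif_neg fun h' => h h')
    · by_cases h : α = β
      · subst h; simp [A.map_mul]
      · simp [h]⟩

open scoped Classical in
theorem canonicalMap_entry {x y : C} (f : x ⟶ y) (α β : G) :
    Orbit.entry (canonicalMap A f) α β =
      if h : α = β then (A.act α).map f ≫ eqToHom (by rw [h]) else 0 := rfl

theorem canonicalMap_entry_self {x y : C} (f : x ⟶ y) (α : G) :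
    Orbit.entry (canonicalMap A f) α α = (A.act α).map f := by
  rw [canonicalMap_entry, dif_pos rfl]; simp

theorem canonicalMap_entry_ne {x y : C} (f : x ⟶ y) {α β : G} (h : α ≠ β) :
    Orbit.entry (canonicalMap A f) α β = 0 := by
  rw [canonicalMap_entry, dif_neg h]

/-- The canonical functor `P : C ⥤ C/G`. -/
noncomputable def canonical : C ⥤ Orbit A where
  obj x := Orbit.of x
  map f := canonicalMap A f
  map_id x := Orbit.hom_ext fun α β => by
    rw [Orbit.entry_id]
    by_cases h : α = β
    · subst h; simp [canonicalMap_entry_self, orbitId]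
    · rw [canonicalMap_entry_ne A _ h]; simp [orbitId, h]
  map_comp f g := Orbit.hom_ext fun α β => by
    rw [Orbit.entry_comp, orbitComp_single _ _ α β α]
    · by_cases h : α = β
      · subst h; simp [canonicalMap_entry_self]
      · simp [canonicalMap_entry_ne A _ h]
    · intro γ hγ; left; simp [canonicalMap_entry_ne A _ hγ.symm]

open scoped Classical in
/-- The morphisms `φ_{μ,x} = (δ_{α,βμ} id_{αx}) : P x ⟶ P (μ x)`. -/
noncomputable def canonicalAdj (μ : G) (x : C) : Orbit.of (A := A) x ⟶ Orbit.of (A.o μ x) :=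
  ⟨fun α β => if h : α = β * μ then eqToHom (by rw [h, A.o_mul]) else 0, by
    refine ⟨fun α => (Set.finite_singleton (α * μ⁻¹)).subset fun β hβ => ?_,
      fun β => (Set.finite_singleton (β * μ)).subset fun α hα => ?_, fun γ α β => ?_⟩
    · by_contra h
      exact hβ (dif_neg fun h' => h (by simp [h']))
    · by_contra h
      exact hα (dif_neg fun h' => h h')
    · by_cases h : α = β * μ
      · subst h; simp [mul_assoc, eqToHom_map]
      · simp [h, mul_assoc]⟩

theorem canonicalAdj_entry_self (μ : G) (x : C) (β : G) :
    Orbit.entry (canonicalAdj A μ x) (β * μ) β = eqToHom (A.o_mul β μ x) := dif_pos rfl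

theorem canonicalAdj_entry_ne (μ : G) (x : C) {α β : G} (h : α ≠ β * μ) :
    Orbit.entry (canonicalAdj A μ x) α β = 0 := dif_neg h

instance : (canonical A).Additive where
  map_add {x y f g} := Orbit.hom_ext fun α β => by
    change Orbit.entry (canonicalMap A (f + g)) α β =
      Orbit.entry (canonicalMap A f) α β + Orbit.entry (canonicalMap A g) α β
    by_cases h : α = β
    · subst h; simp [canonicalMap_entry_self]
    · simp [canonicalMap_entry_ne A _ h]

instance : (canonical A).Linear k where
  map_smul {x y} f r := Orbit.hom_ext fun α β => by
    change Orbit.entry (canonicalMap A (r • f)) α β = r • Orbit.entry (canonicalMap A f) α β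
    by_cases h : α = β
    · subst h; simp [canonicalMap_entry_self]
    · simp [canonicalMap_entry_ne A _ h]

/-- The pullup `M ↦ M ∘ P`. -/
noncomputable def pullup : Md.{w} k (Orbit A) ⥤ Md.{w} k C where
  obj M :=
    { obj := (canonical A).op ⋙ M.obj
      property := ⟨fun x y f g => by
          simpa using M.property.1 _ _ ((canonical A).map f) ((canonical A).map g),
        fun x y r f => by simpa using M.property.2 _ _ r ((canonical A).map f)⟩ }
  map f := ObjectProperty.homMk (Functor.whiskerLeft (canonical A).op f.hom)

/-! ### The pushdown -/

open scoped Classical in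
/-- For `f : x ⟶ y` in `C/G`, the map `⨁_β X(β y) → ⨁_α X(α x)` with matrix `(X(f_{β,α}))`; the
sum defining a column is over the finitely many `α` with `f_{β,α} ≠ 0`. -/
noncomputable def pushRes (X : Md.{w} k C) {x y : Orbit A} (f : x ⟶ y) :
    (DirectSum G fun β => X.ev (A.o β y.base)) →ₗ[k] (DirectSum G fun α => X.ev (A.o α x.base)) :=
  DirectSum.toModule k G _ fun β => ∑ α ∈ (Orbit.finite_col f β).toFinset,
    DirectSum.lof k G (fun α => X.ev (A.o α x.base)) α ∘ₗ X.res (Orbit.entry f α β)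

section
variable {A}
open scoped Classical

theorem lof_eqToHom (X : Md.{w} k C) {α β : G} (x : C) (h : α = β) (m : X.ev (A.o β x)) :
    DirectSum.lof k G (fun α => X.ev (A.o α x)) α
      (X.res (eqToHom (by rw [h]) : A.o α x ⟶ A.o β x) m) =
    DirectSum.lof k G (fun α => X.ev (A.o α x)) β m := by
  subst h; simp

theorem pushRes_lof (X : Md.{w} k C) {x y : Orbit A} (f : x ⟶ y) (β : G) (m : X.ev (A.o β y.base))
    (S : Finset G) (hS : ∀ α, Orbit.entry f α β ≠ 0 → α ∈ S) :
    pushRes A X f (DirectSum.lof k G (fun β => X.ev (A.o β y.base)) β m) =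
      ∑ α ∈ S, DirectSum.lof k G (fun α => X.ev (A.o α x.base)) α (X.res (Orbit.entry f α β) m) := by
  rw [pushRes, DirectSum.toModule_lof, LinearMap.sum_apply]
  refine Finset.sum_subset (fun α h => hS α (by simpa using h)) fun α _ h => ?_
  have : Orbit.entry f α β = 0 := by simpa using h
  simp [this]

theorem pushRes_lof_single (X : Md.{w} k C) {x y : Orbit A} (f : x ⟶ y) (α β : G)
    (m : X.ev (A.o β y.base)) (h : ∀ α', α' ≠ α → Orbit.entry f α' β = 0) :
    pushRes A X f (DirectSum.lof k G (fun β => X.ev (A.o β y.base)) β m) =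
      DirectSum.lof k G (fun α => X.ev (A.o α x.base)) α (X.res (Orbit.entry f α β) m) := by
  rw [pushRes_lof X f β m {α}, Finset.sum_singleton]
  intro α' h'
  by_contra h''
  exact h' (h α' (by simpa using h''))

theorem pushRes_id (X : Md.{w} k C) (x : Orbit A) : pushRes A X (𝟙 x) = LinearMap.id := by
  apply DirectSum.linearMap_ext
  intro β
  refine LinearMap.ext fun m => ?_
  simp only [LinearMap.comp_apply, LinearMap.id_apply]
  rw [pushRes_lof_single X _ β]
  · simp [Orbit.entry_id, orbitId]
  · intro α h; simp [Orbit.entry_id, orbitId, h]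

theorem pushRes_comp (X : Md.{w} k C) {x y z : Orbit A} (f : x ⟶ y) (g : y ⟶ z) :
    pushRes A X (f ≫ g) = pushRes A X f ∘ₗ pushRes A X g := by
  apply DirectSum.linearMap_ext
  intro γ
  refine LinearMap.ext fun m => ?_
  simp only [LinearMap.comp_apply]
  let S := (Orbit.finite_col g γ).toFinset
  have hS : ∀ β, Orbit.entry g β γ ≠ 0 → β ∈ S := by simp [S]
  let U := S.biUnion fun β => (Orbit.finite_col f β).toFinset
  have hU : ∀ β ∈ S, ∀ α, Orbit.entry f α β ≠ 0 → α ∈ U := by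
    intro β hβ α hα
    exact Finset.mem_biUnion.2 ⟨β, hβ, by simpa using hα⟩
  have key : ∀ β ∈ S, pushRes A X f (DirectSum.lof k G (fun β => X.ev (A.o β y.base)) β
      (X.res (Orbit.entry g β γ) m)) =
      ∑ α ∈ U, DirectSum.lof k G (fun α => X.ev (A.o α x.base)) α
        (X.res (Orbit.entry f α β) (X.res (Orbit.entry g β γ) m)) :=
    fun β hβ => pushRes_lof X f β _ U (hU β hβ)
  rw [pushRes_lof X g γ m S hS, map_sum, Finset.sum_congr rfl key, Finset.sum_comm,
    pushRes_lof X (f ≫ g) γ m U]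
  · refine Finset.sum_congr rfl fun α _ => ?_
    rw [Orbit.entry_comp, orbitComp_eq_right _ _ α γ S hS, res_sum, map_sum]
    simp
  · intro α h
    by_contra h'
    apply h
    rw [Orbit.entry_comp, orbitComp_eq_right _ _ α γ S hS]
    refine Finset.sum_eq_zero fun β hβ => ?_
    have : Orbit.entry f α β = 0 := by
      by_contra h''
      exact h' (hU β hβ α h'')
    simp [this]

theorem pushRes_add (X : Md.{w} k C) {x y : Orbit A} (f g : x ⟶ y) :
    pushRes A X (f + g) = pushRes A X f + pushRes A X g := by
  apply DirectSum.linearMap_ext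
  intro β
  refine LinearMap.ext fun m => ?_
  simp only [LinearMap.comp_apply, LinearMap.add_apply]
  let S := (Orbit.finite_col f β).toFinset ∪ (Orbit.finite_col g β).toFinset
  rw [pushRes_lof X f β m S (fun α h => by simp [S, h]),
    pushRes_lof X g β m S (fun α h => by simp [S, h]), pushRes_lof X (f + g) β m S,
    ← Finset.sum_add_distrib]
  · simp
  · intro α h
    by_contra h'
    simp only [S, Finset.mem_union, Set.Finite.mem_toFinset, Set.mem_ofPred_eq, not_or,
      not_not] at h'
    exact h (by simp [h'])

theorem pushRes_smul (X : Md.{w} k C) {x y : Orbit A} (r : k) (f : x ⟶ y) :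
    pushRes A X (r • f) = r • pushRes A X f := by
  apply DirectSum.linearMap_ext
  intro β
  refine LinearMap.ext fun m => ?_
  simp only [LinearMap.comp_apply, LinearMap.smul_apply]
  let S := (Orbit.finite_col f β).toFinset
  rw [pushRes_lof X f β m S (fun α h => by simp [S, h]), pushRes_lof X (r • f) β m S,
    Finset.smul_sum]
  · simp
  · intro α h
    by_contra h'
    simp only [S, Set.Finite.mem_toFinset, Set.mem_ofPred_eq, not_not] at h'
    exact h (by simp [h'])

/-- The map `⨁_α u_{αx} : ⨁_α X(αx) → ⨁_α Y(αx)`. -/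
noncomputable def pushApp (A : GAction k G C) {X Y : Md.{w} k C} (u : X ⟶ Y) (x : Orbit A) :
    (DirectSum G fun α => X.ev (A.o α x.base)) →ₗ[k] (DirectSum G fun α => Y.ev (A.o α x.base)) :=
  DirectSum.lmap fun α => app u (A.o α x.base)

@[simp] theorem pushApp_lof {X Y : Md.{w} k C} (u : X ⟶ Y) (x : Orbit A) (α : G)
    (m : X.ev (A.o α x.base)) :
    pushApp A u x (DirectSum.lof k G (fun α => X.ev (A.o α x.base)) α m) =
      DirectSum.lof k G (fun α => Y.ev (A.o α x.base)) α (app u _ m) := by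
  rw [pushApp, DirectSum.lmap_lof]

theorem pushApp_pushRes {X Y : Md.{w} k C} (u : X ⟶ Y) {x y : Orbit A} (f : x ⟶ y) :
    pushApp A u x ∘ₗ pushRes A X f = pushRes A Y f ∘ₗ pushApp A u y := by
  apply DirectSum.linearMap_ext
  intro β
  refine LinearMap.ext fun m => ?_
  simp only [LinearMap.comp_apply]
  let S := (Orbit.finite_col f β).toFinset
  have hS : ∀ α, Orbit.entry f α β ≠ 0 → α ∈ S := by simp [S]
  rw [pushRes_lof X f β m S hS, pushApp_lof, pushRes_lof Y f β _ S hS, map_sum]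
  simp [app_res]

end

/-- The pushdown `P_• : Mod C ⥤ Mod (C/G)`, `(P_• X)(x) = ⨁_α X(α x)`. -/
noncomputable def pushdown : Md.{w} k C ⥤ Md.{w} k (Orbit A) where
  obj X := mk' (fun x => DirectSum G fun α => X.ev (A.o α x.base)) (fun f => pushRes A X f)
    (pushRes_id X) (pushRes_comp X) (pushRes_add X) (pushRes_smul X)
  map u := homMk' (fun x => pushApp A u x) (fun g m => congr($(pushApp_pushRes u g) m))
  map_id X := hom_ext' fun x m => by
    classical
    have : pushApp A (𝟙 X) x = LinearMap.id := by
      apply DirectSum.linearMap_ext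
      intro α
      refine LinearMap.ext fun m => ?_
      simp
    exact congr($this m)
  map_comp f g := hom_ext' fun x m => by
    classical
    have : pushApp A (f ≫ g) x = pushApp A g x ∘ₗ pushApp A f x := by
      apply DirectSum.linearMap_ext
      intro α
      refine LinearMap.ext fun m => ?_
      simp
    exact congr($this m)

instance : (pushdown A).Additive where
  map_add {X Y f g} := hom_ext' fun x m => by
    classical
    have : pushApp A (f + g) x = pushApp A f x + pushApp A g x := by
      apply DirectSum.linearMap_ext
      intro α
      refine LinearMap.ext fun m => ?_
      simp
    exact congr($this m)

instance : (pushdown A).Linear k where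
  map_smul {X Y} f r := hom_ext' fun x m => by
    classical
    have : pushApp A (r • f) x = r • pushApp A f x := by
      apply DirectSum.linearMap_ext
      intro α
      refine LinearMap.ext fun m => ?_
      simp
    exact congr($this m)

theorem pushdown_res (X : Md.{w} k C) {x y : Orbit A} (f : x ⟶ y) :
    ((pushdown A).obj X).res f = pushRes A X f := rfl

theorem pushdown_app {X Y : Md.{w} k C} (u : X ⟶ Y) (x : Orbit A) :
    app ((pushdown A).map u) x = pushApp A u x := rfl

open scoped Classical in
/-- The morphisms `P_• X ⟶ P_• (ᵘX)`, with component `⨁_α X(αx) → ⨁_β X(μ⁻¹βx)` at `x` given by the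
matrix `(δ_{α, μ⁻¹β} id_{X(αx)})`. -/
noncomputable def pushAdjApp (μ : G) (X : Md.{w} k C) (x : Orbit A) :
    (DirectSum G fun α => X.ev (A.o α x.base)) →ₗ[k]
      (DirectSum G fun β => (((actMd.{w} A).act μ).obj X).ev (A.o β x.base)) :=
  DirectSum.toModule k G _ fun α =>
    DirectSum.lof k G (fun β => (((actMd.{w} A).act μ).obj X).ev (A.o β x.base)) (μ * α) ∘ₗ
      X.res (eqToHom (by rw [← A.o_mul, inv_mul_cancel_left]) :
        A.o μ⁻¹ (A.o (μ * α) x.base) ⟶ A.o α x.base)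

section
variable {A}
open scoped Classical

theorem pushAdjApp_lof (μ : G) (X : Md.{w} k C) (x : Orbit A) (α : G) (m : X.ev (A.o α x.base)) :
    pushAdjApp A μ X x (DirectSum.lof k G (fun α => X.ev (A.o α x.base)) α m) =
      DirectSum.lof k G (fun β => (((actMd.{w} A).act μ).obj X).ev (A.o β x.base)) (μ * α)
        (X.res (eqToHom (by rw [← A.o_mul, inv_mul_cancel_left]) :
          A.o μ⁻¹ (A.o (μ * α) x.base) ⟶ A.o α x.base) m) := by
  rw [pushAdjApp, DirectSum.toModule_lof]
  rfl

theorem pushAdjApp_naturality (μ : G) (X : Md.{w} k C) {x y : Orbit A} (f : x ⟶ y) :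
    pushAdjApp A μ X x ∘ₗ pushRes A X f =
      pushRes A (((actMd.{w} A).act μ).obj X) f ∘ₗ pushAdjApp A μ X y := by
  apply DirectSum.linearMap_ext
  intro β
  refine LinearMap.ext fun m => ?_
  simp only [LinearMap.comp_apply]
  let S := (Orbit.finite_col f β).toFinset
  have hS : ∀ α, Orbit.entry f α β ≠ 0 → α ∈ S := by simp [S]
  rw [pushRes_lof X f β m S hS, pushAdjApp_lof, map_sum]
  refine Eq.trans ?_ (pushRes_lof (((actMd.{w} A).act μ).obj X) f (μ * β) _
    (S.image (μ * ·)) ?_).symm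
  · rw [Finset.sum_image (by intro a _ b _ h; exact mul_left_cancel h)]
    refine Finset.sum_congr rfl fun α _ => ?_
    rw [pushAdjApp_lof]
    change DirectSum.lof k G (fun β => (((actMd.{w} A).act μ).obj X).ev (A.o β x.base)) (μ * α) _ =
      DirectSum.lof k G (fun β => (((actMd.{w} A).act μ).obj X).ev (A.o β x.base)) (μ * α)
        (X.res ((A.act μ⁻¹).map (Orbit.entry f (μ * α) (μ * β))) _)
    congr 1
    rw [← res_comp, ← res_comp]
    congr 2
    rw [Orbit.entry_mul]
    have h := A.map_mul μ⁻¹ μ (Orbit.entry f α β)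
    rw [A.map_eq (inv_mul_cancel μ), A.map_one] at h
    have h' : (A.act μ⁻¹).map ((A.act μ).map (Orbit.entry f α β)) =
      eqToHom (A.o_inv_o μ _) ≫ Orbit.entry f α β ≫ eqToHom (A.o_inv_o μ _).symm := by
      rw [← cancel_epi (eqToHom (A.o_mul μ⁻¹ μ _)), ← cancel_mono (eqToHom (A.o_mul μ⁻¹ μ _).symm)]
      simp only [Category.assoc, eqToHom_trans, eqToHom_trans_assoc] at h ⊢
      exact h.symm
    simp only [Functor.map_comp, h', eqToHom_map, Category.assoc, eqToHom_trans,
      eqToHom_trans_assoc, eqToHom_refl, Category.comp_id]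
  · intro α hα
    obtain ⟨α, rfl⟩ : ∃ δ, α = μ * δ := ⟨μ⁻¹ * α, by simp⟩
    refine Finset.mem_image.2 ⟨α, hS α fun h => hα ?_, rfl⟩
    rw [Orbit.entry_mul, h]
    simp

theorem pushApp_pushAdjApp (μ : G) {X Y : Md.{w} k C} (u : X ⟶ Y) (x : Orbit A) :
    pushApp A (((actMd.{w} A).act μ).map u) x ∘ₗ pushAdjApp A μ X x =
      pushAdjApp A μ Y x ∘ₗ pushApp A u x := by
  apply DirectSum.linearMap_ext
  intro α
  refine LinearMap.ext fun m => ?_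
  simp only [LinearMap.comp_apply]
  rw [pushAdjApp_lof, pushApp_lof, pushAdjApp_lof]
  refine (pushApp_lof (((actMd.{w} A).act μ).map u) x (μ * α) _).trans ?_
  rw [← app_res]
  rfl

end

/-- The morphisms `φ_{•,μ} : P_• ⟶ P_• ∘ ᵘ(-)` of functors `Mod C ⥤ Mod (C/G)`. -/
noncomputable def pushAdj (μ : G) : pushdown A ⟶ (actMd.{w} A).act μ ⋙ pushdown A where
  app X := homMk' (fun x => pushAdjApp A μ X x)
    (fun g m => congr($(pushAdjApp_naturality μ X g) m))
  naturality X Y u := hom_ext' fun x m => congr($((pushApp_pushAdjApp μ u x).symm) m)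

/-! ### The adjunction between pushdown and pullup -/

section
variable {A}
open scoped Classical

theorem pushRes_canonicalMap (X : Md.{w} k C) {x y : C} (f : x ⟶ y) (β : G)
    (m : X.ev (A.o β y)) :
    pushRes A X (canonicalMap A f) (DirectSum.lof k G (fun β => X.ev (A.o β y)) β m) =
      DirectSum.lof k G (fun β => X.ev (A.o β x)) β (X.res ((A.act β).map f) m) := by
  refine (pushRes_lof_single X _ β β m ?_).trans ?_
  · intro α h; exact canonicalMap_entry_ne A _ h
  · rw [canonicalMap_entry_self]

theorem pushRes_canonicalAdj (X : Md.{w} k C) (μ : G) (x : C) (β : G)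
    (m : X.ev (A.o β (A.o μ x))) :
    pushRes A X (canonicalAdj A μ x)
        (DirectSum.lof k G (fun β => X.ev (A.o β (A.o μ x))) β m) =
      DirectSum.lof k G (fun β => X.ev (A.o β x)) (β * μ)
        (X.res (eqToHom (A.o_mul β μ x)) m) := by
  refine (pushRes_lof_single X _ (β * μ) β m ?_).trans ?_
  · intro α h; exact canonicalAdj_entry_ne A _ _ h
  · rw [canonicalAdj_entry_self]

theorem canonicalAdj_one (x : C) :
    canonicalAdj A 1 x ≫ canonicalMap A (eqToHom (A.o_one x)) = 𝟙 _ := by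
  refine Orbit.hom_ext fun α β => ?_
  rw [Orbit.entry_comp, orbitComp_single _ _ α β β, Orbit.entry_id, canonicalMap_entry_self]
  · by_cases h : α = β * 1
    · subst h
      rw [canonicalAdj_entry_self]
      simp [orbitId, eqToHom_map]
    · rw [canonicalAdj_entry_ne A _ _ h]
      simp only [mul_one] at h
      simp [orbitId, h]
  · intro γ h; right; exact canonicalMap_entry_ne A _ h

theorem comp_canonicalAdj {x y : C} (g : Orbit.of (A := A) x ⟶ Orbit.of y) (β : G) (S : Finset G)
    (hS : ∀ α, Orbit.entry g α β ≠ 0 → α ∈ S) :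
    g ≫ canonicalAdj A β y =
      ∑ α ∈ S, canonicalAdj A α x ≫ canonicalMap A (Orbit.entry g α β) := by
  refine Orbit.hom_ext fun α' β' => ?_
  rw [Orbit.entry_sum, Orbit.entry_comp, orbitComp_single _ _ α' β' (β' * β)]
  · obtain ⟨α, rfl⟩ : ∃ δ, α' = β' * δ := ⟨β'⁻¹ * α', by simp⟩
    have key : ∀ δ, Orbit.entry (canonicalAdj A δ x ≫
        canonicalMap A (Orbit.entry g δ β)) (β' * α) β' =
        Orbit.entry (canonicalAdj A δ x) (β' * α) β' ≫
          (A.act β').map (Orbit.entry g δ β) := by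
      intro δ
      rw [Orbit.entry_comp, orbitComp_single _ _ (β' * α) β' β', canonicalMap_entry_self]
      intro γ h; right; exact canonicalMap_entry_ne A _ h
    rw [Finset.sum_congr rfl fun δ _ => key δ, Orbit.entry_mul, canonicalAdj_entry_self]
    simp only [Category.assoc, eqToHom_trans, eqToHom_refl]
    by_cases h : α ∈ S
    · rw [Finset.sum_eq_single_of_mem α h, canonicalAdj_entry_self]
      · exact congrArg (eqToHom _ ≫ ·) (Category.comp_id _)
      · intro δ _ h
        rw [canonicalAdj_entry_ne A _ _ (by simpa using h.symm), zero_comp]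
    · rw [Finset.sum_eq_zero]
      · have : Orbit.entry g α β = 0 := by
          by_contra h'; exact h (hS α h')
        simp [this]
      · intro δ hδ
        rw [canonicalAdj_entry_ne, zero_comp]
        intro h'
        rw [mul_right_inj] at h'
        exact h (h' ▸ hδ)
  · intro γ h; right; exact canonicalAdj_entry_ne A _ _ h

/-- The component at `x` of a morphism to a pullup. -/
noncomputable def pullApp {X : Md.{w} k C} {Y : Md.{w} k (Orbit A)} (f : X ⟶ (pullup A).obj Y)
    (x : C) : X.ev x →ₗ[k] Y.ev (Orbit.of x) := app f x

theorem pullApp_res {X : Md.{w} k C} {Y : Md.{w} k (Orbit A)} (f : X ⟶ (pullup A).obj Y)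
    {x y : C} (g : x ⟶ y) (m : X.ev y) :
    pullApp f x (X.res g m) = Y.res (canonicalMap A g) (pullApp f y m) := app_res f g m

/-- The map `(Y(φ_{α,x}) f_{αx})_α : ⨁_α X(αx) → Y(x)`. -/
noncomputable def pushDesc {X : Md.{w} k C} {Y : Md.{w} k (Orbit A)} (f : X ⟶ (pullup A).obj Y)
    (x : C) : (DirectSum G fun α => X.ev (A.o α x)) →ₗ[k] Y.ev (Orbit.of x) :=
  DirectSum.toModule k G _ fun α => Y.res (canonicalAdj A α x) ∘ₗ pullApp f (A.o α x)

theorem pushDesc_lof {X : Md.{w} k C} {Y : Md.{w} k (Orbit A)} (f : X ⟶ (pullup A).obj Y)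
    (x : C) (α : G) (m : X.ev (A.o α x)) :
    pushDesc f x (DirectSum.lof k G (fun α => X.ev (A.o α x)) α m) =
      Y.res (canonicalAdj A α x) (pullApp f (A.o α x) m) := by
  rw [pushDesc, DirectSum.toModule_lof]; rfl

theorem pushDesc_naturality {X : Md.{w} k C} {Y : Md.{w} k (Orbit A)} (f : X ⟶ (pullup A).obj Y)
    {x y : C} (g : Orbit.of (A := A) x ⟶ Orbit.of y) :
    pushDesc f x ∘ₗ pushRes A X g = Y.res g ∘ₗ pushDesc f y := by
  apply DirectSum.linearMap_ext
  intro β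
  refine LinearMap.ext fun m => ?_
  simp only [LinearMap.comp_apply]
  let S := (Orbit.finite_col g β).toFinset
  have hS : ∀ α, Orbit.entry g α β ≠ 0 → α ∈ S := by simp [S]
  rw [pushRes_lof X g β m S hS, map_sum, pushDesc_lof, ← res_comp, comp_canonicalAdj g β S hS,
    res_sum]
  refine Finset.sum_congr rfl fun α _ => ?_
  rw [pushDesc_lof, pullApp_res, res_comp]

/-- The map `m ↦ t(m)` where `m` is regarded as an element of the summand for `α = 1`. -/
noncomputable def pushRestrict {X : Md.{w} k C} {Y : Md.{w} k (Orbit A)}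
    (t : (pushdown A).obj X ⟶ Y) (x : C) : X.ev x →ₗ[k] Y.ev (Orbit.of x) :=
  app t (Orbit.of x) ∘ₗ DirectSum.lof k G (fun α => X.ev (A.o α x)) 1 ∘ₗ
    X.res (eqToHom (A.o_one x))

theorem pushRestrict_naturality {X : Md.{w} k C} {Y : Md.{w} k (Orbit A)}
    (t : (pushdown A).obj X ⟶ Y) {x y : C} (g : x ⟶ y) (m : X.ev y) :
    pushRestrict t x (X.res g m) = Y.res (canonicalMap A g) (pushRestrict t y m) := by
  have h1 := app_res t (canonicalMap A g)
    (DirectSum.lof k G (fun α => X.ev (A.o α y)) 1 (X.res (eqToHom (A.o_one y)) m))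
  refine Eq.trans ?_ h1
  refine congrArg (app t (Orbit.of x)) ?_
  refine Eq.trans ?_ (pushRes_canonicalMap X g 1 _).symm
  refine congrArg (DirectSum.lof k G (fun α => X.ev (A.o α x)) 1) ?_
  rw [A.map_one, ← res_comp, ← res_comp]
  simp

theorem pushDesc_restrict {X : Md.{w} k C} {Y : Md.{w} k (Orbit A)}
    (t : (pushdown A).obj X ⟶ Y) (f : X ⟶ (pullup A).obj Y)
    (h : ∀ x, pullApp f x = pushRestrict t x) (x : C) :
    pushDesc f x = app t (Orbit.of x) := by
  apply DirectSum.linearMap_ext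
  intro α
  refine LinearMap.ext fun m => ?_
  simp only [LinearMap.comp_apply]
  rw [pushDesc_lof, h]
  refine (app_res t (canonicalAdj A α x) _).symm.trans ?_
  refine congrArg (app t (Orbit.of x)) ?_
  refine (pushRes_canonicalAdj X α x 1 _).trans ?_
  rw [← res_comp, eqToHom_trans]
  exact lof_eqToHom X x (one_mul α) m

theorem restrict_pushDesc {X : Md.{w} k C} {Y : Md.{w} k (Orbit A)}
    (f : X ⟶ (pullup A).obj Y) (x : C) (m : X.ev x) :
    pushDesc f x (DirectSum.lof k G (fun α => X.ev (A.o α x)) 1 (X.res (eqToHom (A.o_one x)) m)) =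
      pullApp f x m := by
  rw [pushDesc_lof, pullApp_res, ← res_comp, canonicalAdj_one, res_id]

end

/-- The pushdown is left adjoint to the pullup. -/
noncomputable def pushPullAdj : pushdown A ⊣ pullup A :=
  Adjunction.mkOfHomEquiv
    { homEquiv X Y :=
        { toFun t := homMk' (fun x => pushRestrict t x) (pushRestrict_naturality t)
          invFun f := homMk' (fun x => pushDesc f x.base)
            (fun g m => congr($(pushDesc_naturality f g) m))
          left_inv t := hom_ext' fun x m =>
            congr($(pushDesc_restrict t _ (fun _ => rfl) x.base) m)
          right_inv f := hom_ext' fun x m => restrict_pushDesc f x m }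
      homEquiv_naturality_left_symm {X' X Y} f g := hom_ext' fun x m => by
        classical
        have : pushDesc (f ≫ g) x.base = pushDesc g x.base ∘ₗ pushApp A f x := by
          apply DirectSum.linearMap_ext
          intro α
          refine LinearMap.ext fun m => ?_
          simp only [LinearMap.comp_apply]
          rw [pushDesc_lof, pushApp_lof, pushDesc_lof]
          rfl
        exact congr($this m)
      homEquiv_naturality_right {X Y Y'} f g := rfl }

theorem pushdown_projective (X : Md.{w} k C) (hX : Projective X) :
    Projective ((pushdown A).obj X) := by
  have : (pullup A).PreservesEpimorphisms :=
    ⟨fun p _ => epi_of_surjective _ fun x => surjective_of_epi p (Orbit.of x)⟩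
  exact (pushPullAdj A).map_projective X hX

theorem pushdown_fg (X : Md.{w} k C) (hX : X.FG) : ((pushdown A).obj X).FG := by
  classical
  have := (pushPullAdj A).isLeftAdjoint
  refine fg_of_functor (pushdown A) (fun p _ => inferInstance) (fun x => ?_) X hX
  let e : (rep.{w} (k := k) x).ev (A.o 1 x) := ULift.up (eqToHom (A.o_one x))
  let e' : ((pushdown A).obj (rep x)).ev (Orbit.of x) :=
    DirectSum.lof k G (fun α => (rep.{w} (k := k) x).ev (A.o α x)) 1 e
  refine ⟨Orbit.of x, fromRep _ _ e', epi_of_surjective _ fun y => ?_⟩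
  rw [← LinearMap.range_eq_top, eq_top_iff]
  rintro m -
  change DirectSum G (fun α => (rep.{w} (k := k) x).ev (A.o α y.base)) at m
  induction m using DirectSum.induction_on with
  | zero => exact zero_mem _
  | add a b ha hb => exact add_mem ha hb
  | of α g =>
    obtain ⟨g⟩ := g
    change A.o α y.base ⟶ x at g
    refine ⟨ULift.up (canonicalAdj A α y.base ≫ canonicalMap A g), ?_⟩
    have h1 : pushRes A (rep x) (canonicalMap A g) e' =
        DirectSum.lof k G (fun β => (rep.{w} (k := k) x).ev (A.o β (A.o α y.base))) 1
          ((rep x).res ((A.act 1).map g) e) := pushRes_canonicalMap (rep x) g 1 e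
    have h2 := pushRes_canonicalAdj (rep x) α y.base 1 ((rep x).res ((A.act 1).map g) e)
    refine ((res_comp _ (canonicalAdj A α y.base) (canonicalMap A g) e').trans
      ((congrArg _ h1).trans h2)).trans ?_
    refine Eq.trans ?_ (lof_eqToHom (rep x) y.base (one_mul α) (ULift.up g))
    congr 1
    apply ULift.ext
    change eqToHom (A.o_mul 1 α y.base) ≫ (A.act 1).map g ≫ eqToHom (A.o_one x) =
      eqToHom (by rw [one_mul]) ≫ g
    rw [A.map_one]
    simp

end Pushdown

section Homotopy

/-! ### The induced functors between homotopy categories -/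

variable {k : Type uk} [CommRing k] {C : Type u} [Category.{v} C] [Preadditive C] [Linear k C]
  {D : Type u'} [Category.{v'} D] [Preadditive D] [Linear k D]

/-- The functor preserves projectives and finite generation. -/
structure PresPrj (T : Md.{t} k C ⥤ Md.{t'} k D) : Prop where
  proj : ∀ X, Projective X → Projective (T.obj X)
  fg : ∀ X : Md.{t} k C, X.FG → (T.obj X).FG

/-- The functor `Prj C ⥤ Prj D` induced by `T : Mod C ⥤ Mod D`. -/
def prjFunctor (T : Md.{t} k C ⥤ Md.{t'} k D) (hT : PresPrj T) : Prj.{t} k C ⥤ Prj.{t'} k D :=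
  ObjectProperty.lift _ (ObjectProperty.ι _ ⋙ T) fun X => hT.proj _ X.property

instance (T : Md.{t} k C ⥤ Md.{t'} k D) (hT : PresPrj T) [T.Additive] :
    (prjFunctor T hT).Additive where
  map_add {X Y f g} := ObjectProperty.hom_ext _ (T.map_add (f := f.hom) (g := g.hom))

instance (T : Md.{t} k C ⥤ Md.{t'} k D) (hT : PresPrj T) [T.Additive] [T.Linear k] :
    (prjFunctor T hT).Linear k where
  map_smul {X Y} f r := ObjectProperty.hom_ext _ (T.map_smul r f.hom)

/-- The functor `K(Prj C) ⥤ K(Prj D)` induced by `T`, degreewise on complexes. -/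
def kFunctor (T : Md.{t} k C ⥤ Md.{t'} k D) [T.Additive] (hT : PresPrj T) :
    KPrj.{t} k C ⥤ KPrj.{t'} k D :=
  (prjFunctor T hT).mapHomotopyCategory (ComplexShape.up ℤ)

instance (T : Md.{t} k C ⥤ Md.{t'} k D) (hT : PresPrj T) [T.Additive] :
    (kFunctor T hT).Additive :=
  inferInstanceAs ((prjFunctor T hT).mapHomotopyCategory (ComplexShape.up ℤ)).Additive

instance (T : Md.{t} k C ⥤ Md.{t'} k D) (hT : PresPrj T) [T.Additive] [T.Linear k] :
    (kFunctor T hT).Linear k :=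
  inferInstanceAs (((prjFunctor T hT).mapHomotopyCategory (ComplexShape.up ℤ)).Linear k)

theorem kFunctor_isBoundedFG (T : Md.{t} k C ⥤ Md.{t'} k D) [T.Additive] (hT : PresPrj T)
    (X : KPrj.{t} k C) (hX : isBoundedFG k C X) : isBoundedFG k D ((kFunctor T hT).obj X) := by
  obtain ⟨h, a, b, hab⟩ := hX
  exact ⟨fun i => hT.fg _ (h i), a, b, fun i hi => (prjFunctor T hT).map_isZero (hab i hi)⟩

/-- The functor `K^b(prj C) ⥤ K^b(prj D)` induced by `T`. -/
def kbFunctor (T : Md.{t} k C ⥤ Md.{t'} k D) [T.Additive] (hT : PresPrj T) :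
    Kb.{t} k C ⥤ Kb.{t'} k D :=
  ObjectProperty.lift _ (ObjectProperty.ι _ ⋙ kFunctor T hT)
    fun X => kFunctor_isBoundedFG T hT _ X.property

instance (T : Md.{t} k C ⥤ Md.{t'} k D) (hT : PresPrj T) [T.Additive] :
    (kbFunctor T hT).Additive where
  map_add {X Y f g} := ObjectProperty.hom_ext _ ((kFunctor T hT).map_add (f := f.hom) (g := g.hom))

instance (T : Md.{t} k C ⥤ Md.{t'} k D) (hT : PresPrj T) [T.Additive] [T.Linear k] :
    (kbFunctor T hT).Linear k where
  map_smul {X Y} f r := ObjectProperty.hom_ext _ ((kFunctor T hT).map_smul r f.hom)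

theorem kbFunctor_id (T : Md.{t} k C ⥤ Md.{t} k C) [T.Additive] (hT : PresPrj T)
    (h : T = 𝟭 _) : kbFunctor T hT = 𝟭 _ := by
  subst h
  refine CategoryTheory.Functor.ext (fun _ => rfl) ?_
  rintro X Y ⟨f⟩
  obtain ⟨f, rfl⟩ := (HomotopyCategory.quotient _ _).map_surjective f
  exact ((Category.id_comp _).trans (Category.comp_id _)).symm

theorem kbFunctor_comp (T S U : Md.{t} k C ⥤ Md.{t} k C) [T.Additive] [S.Additive] [U.Additive]
    (hT : PresPrj T) (hS : PresPrj S) (hU : PresPrj U) (h : T = S ⋙ U) :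
    kbFunctor T hT = kbFunctor S hS ⋙ kbFunctor U hU := by
  subst h
  refine CategoryTheory.Functor.ext (fun _ => rfl) ?_
  rintro X Y ⟨f⟩
  obtain ⟨f, rfl⟩ := (HomotopyCategory.quotient _ _).map_surjective f
  exact ((Category.id_comp _).trans (Category.comp_id _)).symm

end Homotopy

section Main

variable {k : Type uk} [CommRing k] {G : Type w} [Group G]
  {C : Type u} [Category.{v} C] [Preadditive C] [Linear k C] (A : GAction k G C)

theorem actMd_presPrj (α : G) : PresPrj ((actMd.{t} A).act α) :=
  ⟨fun X hX => (actMd.{t} A).map_projective α X hX, actMd_fg A α⟩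

theorem pushdown_presPrj : PresPrj (pushdown A) :=
  ⟨pushdown_projective A, pushdown_fg A⟩

/-- The `G`-action on `K^b(prj C)`: `ᵅ(Xⁱ, dⁱ) = (ᵅXⁱ, ᵅdⁱ)`. -/
def actKb : GAction k G (Kb.{t} k C) where
  act α := kbFunctor ((actMd.{t} A).act α) (actMd_presPrj A α)
  additive _ := inferInstance
  linear _ := inferInstance
  act_one := kbFunctor_id _ _ (actMd.{t} A).act_one
  act_mul β α := kbFunctor_comp _ _ _ _ _ _ ((actMd.{t} A).act_mul β α)

/-- The pushdown functor `P_• : K^b(prj C) ⥤ K^b(prj (C/G))`. -/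
noncomputable def pushdownKb : Kb.{w} k C ⥤ Kb.{w} k (Orbit A) :=
  kbFunctor (pushdown A) (pushdown_presPrj A)

instance : (pushdownKb A).Additive :=
  inferInstanceAs (kbFunctor (pushdown A) (pushdown_presPrj A)).Additive

instance : (pushdownKb A).Linear k :=
  inferInstanceAs ((kbFunctor (pushdown A) (pushdown_presPrj A)).Linear k)

/-- The morphism of complexes which is `φ_{•,μ}` in every degree. -/
noncomputable def pushAdjComplex (μ : G) (X : HomologicalComplex (Prj.{w} k C) (ComplexShape.up ℤ)) :
    ((prjFunctor (pushdown A) (pushdown_presPrj A)).mapHomologicalComplex _).obj X ⟶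
      ((prjFunctor (pushdown A) (pushdown_presPrj A)).mapHomologicalComplex _).obj
        (((prjFunctor ((actMd.{w} A).act μ) (actMd_presPrj A μ)).mapHomologicalComplex _).obj X)
    where
  f i := ObjectProperty.homMk ((pushAdj A μ).app (X.X i).obj)
  comm' i j _ := ObjectProperty.hom_ext _ ((pushAdj A μ).naturality (X.d i j).hom).symm

/-- The morphisms `P_• ⟶ P_• ∘ ᵘ(-)` of functors `K^b(prj C) ⥤ K^b(prj (C/G))`, given by
`φ_{•,μ}` in every degree. -/
noncomputable def pushAdjKb (μ : G) : pushdownKb A ⟶ (actKb.{w} A).act μ ⋙ pushdownKb A where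
  app X := ObjectProperty.homMk
    ((HomotopyCategory.quotient _ _).map (pushAdjComplex A μ X.obj.as))
  naturality X Y := by
    rintro ⟨f⟩
    obtain ⟨f, rfl⟩ := (HomotopyCategory.quotient _ _).map_surjective f
    apply ObjectProperty.hom_ext
    refine congrArg (HomotopyCategory.quotient _ _).map
      (?_ : ((prjFunctor (pushdown A) (pushdown_presPrj A)).mapHomologicalComplex _).map f ≫
          pushAdjComplex A μ Y.obj.as =
        pushAdjComplex A μ X.obj.as ≫
          ((prjFunctor (pushdown A) (pushdown_presPrj A)).mapHomologicalComplex _).map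
            (((prjFunctor ((actMd.{w} A).act μ) (actMd_presPrj A μ)).mapHomologicalComplex _).map
              f))
    ext i : 1
    exact ObjectProperty.hom_ext _ ((pushAdj A μ).naturality (f.f i).hom)

end Main

end Covering

/-! Everything is decided at the level of modules. By the adjunction `pushPullAdj`, a morphism f :
P_•X → P_•Y amounts to maps X(x) → ⨁_α Y(αx) natural in x ∈ R. A morphism P(g) acts diagonally on
this direct sum, so for each α the α-th coordinates alone form a morphism ᵅX → Y, the component
`pushComp α f`; together the components determine f (`eq_zero_of_pushComp`). The morphism φ_β
followed by P_•(g) has β-th component g and all others zero (`pushComp_pushAdj_self`,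
`pushComp_pushAdj_ne`). If X is finitely generated, f sends each of finitely many generators to an
element with finitely many coordinates, so almost all components of f vanish (`finite_pushComp`),
and f is the finite sum of the φ_α followed by P_•(f_α) (`eq_sum_pushComp`).

Taking components is additive and natural in X and in Y. This is enough to carry it degreewise to
complexes and to null homotopies (`HomTransfer.complex`, `HomTransfer.homotopy`). Surjectivity: a
chain map P_•X → P_•Y has finitely many non-zero components because X has finitely many non-zero
degrees, each finitely generated, and it is the sum of the morphisms built from them. Injectivity:
if the sum of the φ_α followed by P_•(f_α) is null homotopic, the α-th component of the homotopy is
a null homotopy of f_α. Each α is treated separately, so no finiteness of the homotopy is needed.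

As for the adjuster, φ_μ only relabels the summand α as μα. The identities for φ_1 and φ_{βα} are
therefore checked on modules, carried to complexes, and invertibility follows formally from them. -/

namespace Covering

/-! ### Invertibility of an invariance adjuster -/

section AdjusterCriterion

variable {k : Type uk} [CommRing k] {G : Type w} [Group G]
  {C : Type u} [Category.{v} C] [Preadditive C] [Linear k C] (A : GAction k G C)
  {D : Type u'} [Category.{v'} D]

/-- The invertibility of an invariance adjuster follows from its multiplicativity. -/
theorem IsInvarianceAdjuster.of_one_mul (F : C ⥤ D) (φ : ∀ α : G, F ⟶ A.act α ⋙ F)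
    (one : ∀ x : C, (φ 1).app x ≫ F.map (eqToHom (A.o_one x)) = 𝟙 (F.obj x))
    (mul : ∀ (β α : G) (x : C),
      (φ (β * α)).app x ≫ F.map (eqToHom (A.o_mul β α x)) =
        (φ α).app x ≫ (φ β).app (A.o α x)) :
    IsInvarianceAdjuster A F φ where
  one := one
  mul := mul
  isIso := by
    have h1 : ∀ x, IsIso ((φ 1).app x) := fun x => by
      have := one x
      rw [← IsIso.eq_comp_inv] at this
      rw [this]
      infer_instance
    -- Stated for any γ equal to 1 because `mul` produces the index β * α, which is 1 only
    -- propositionally.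
    have h2 : ∀ (γ : G) (_ : γ = 1) (x : C), IsIso ((φ γ).app x) := by
      rintro _ rfl x; exact h1 x
    have h3 : ∀ (β α : G) (_ : β * α = 1) (x : C),
        IsIso ((φ α).app x ≫ (φ β).app (A.o α x)) := fun β α h x => by
      rw [← mul]
      have := h2 _ h x
      infer_instance
    have h4 : ∀ α x, Mono ((φ α).app x) := fun α x => by
      have := h3 α⁻¹ α (inv_mul_cancel α) x
      exact mono_of_mono _ ((φ α⁻¹).app (A.o α x))
    -- The composite of φ_α at x with φ_{α⁻¹} at αx is invertible, so the second factor is split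
    -- epi. It is also mono by `h4`, hence invertible, and then so is the first factor.
    have h5 : ∀ α x, IsIso ((φ α).app x) := fun α x => by
      have i1 := h3 α⁻¹ α (inv_mul_cancel α) x
      have i2 := h4 α⁻¹ (A.o α x)
      have i3 : IsSplitEpi ((φ α⁻¹).app (A.o α x)) :=
        ⟨⟨⟨inv ((φ α).app x ≫ (φ α⁻¹).app (A.o α x)) ≫ (φ α).app x, by simp⟩⟩⟩
      have i4 : IsIso ((φ α⁻¹).app (A.o α x)) := isIso_of_mono_of_isSplitEpi _
      exact IsIso.of_isIso_comp_right _ ((φ α⁻¹).app (A.o α x))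
    exact fun α => NatIso.isIso_of_isIso_app _

end AdjusterCriterion

/-! ### Components ᵅX → Y of a morphism P_•X → P_•Y -/

section Components

open Md
open scoped Classical

variable {k : Type uk} [CommRing k] {G : Type w} [Group G]
  {C : Type u} [Category.{v} C] [Preadditive C] [Linear k C] {A : GAction k G C}

/-- The component at `x` of a morphism out of `ᵅX`. -/
def actApp {α : G} {X Y : Md.{t} k C} (f : ((actMd.{t} A).act α).obj X ⟶ Y) (x : C) :
    X.ev (A.o α⁻¹ x) →ₗ[k] Y.ev x := app f x

theorem actApp_ext {α : G} {X Y : Md.{t} k C} {f g : ((actMd.{t} A).act α).obj X ⟶ Y}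
    (h : ∀ x (m : X.ev (A.o α⁻¹ x)), actApp f x m = actApp g x m) : f = g :=
  hom_ext' h

theorem actApp_res {α : G} {X Y : Md.{t} k C} (f : ((actMd.{t} A).act α).obj X ⟶ Y) {x y : C}
    (g : x ⟶ y) (m : X.ev (A.o α⁻¹ y)) :
    actApp f x (X.res ((A.act α⁻¹).map g) m) = Y.res g (actApp f y m) :=
  app_res f g m

theorem actApp_add {α : G} {X Y : Md.{t} k C} (f g : ((actMd.{t} A).act α).obj X ⟶ Y) (x : C)
    (m : X.ev (A.o α⁻¹ x)) : actApp (f + g) x m = actApp f x m + actApp g x m := rfl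

theorem actApp_zero {α : G} {X Y : Md.{t} k C} (x : C) (m : X.ev (A.o α⁻¹ x)) :
    actApp (0 : ((actMd.{t} A).act α).obj X ⟶ Y) x m = 0 := rfl

theorem actApp_comp {α : G} {X Y Z : Md.{t} k C} (f : ((actMd.{t} A).act α).obj X ⟶ Y)
    (g : Y ⟶ Z) (x : C) (m : X.ev (A.o α⁻¹ x)) :
    actApp (f ≫ g) x m = app g x (actApp f x m) := rfl

theorem actApp_map_comp {α : G} {X Y Z : Md.{t} k C} (u : X ⟶ Y)
    (f : ((actMd.{t} A).act α).obj Y ⟶ Z) (x : C) (m : X.ev (A.o α⁻¹ x)) :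
    actApp (((actMd.{t} A).act α).map u ≫ f) x m = actApp f x (app u _ m) := rfl

/-- The `α`-th coordinate of an element of `(P_• Y)(x)`. -/
noncomputable def pushCoord (Y : Md.{w} k C) (x : C) (α : G) :
    ((pushdown A).obj Y).ev (Orbit.of x) →ₗ[k] Y.ev (A.o α x) :=
  DirectSum.component k G (fun α => Y.ev (A.o α x)) α

theorem pushCoord_ext {Y : Md.{w} k C} {x : C}
    {m m' : ((pushdown A).obj Y).ev (Orbit.of x)}
    (h : ∀ α, pushCoord Y x α m = pushCoord Y x α m') : m = m' :=
  DirectSum.ext_component k h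

theorem pushCoord_lof_self (Y : Md.{w} k C) (x : C) (α : G) (m : Y.ev (A.o α x)) :
    pushCoord Y x α (DirectSum.lof k G (fun α => Y.ev (A.o α x)) α m) = m :=
  DirectSum.component.lof_self (M := fun α => Y.ev (A.o α x)) k α m

theorem pushCoord_lof_ne (Y : Md.{w} k C) (x : C) {α β : G} (h : α ≠ β) (m : Y.ev (A.o α x)) :
    pushCoord Y x β (DirectSum.lof k G (fun α => Y.ev (A.o α x)) α m) = 0 :=
  (DirectSum.component.of (M := fun α => Y.ev (A.o α x)) k β α m).trans (dif_neg h)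

theorem finite_pushCoord (Y : Md.{w} k C) (x : C) (m : ((pushdown A).obj Y).ev (Orbit.of x)) :
    {α | pushCoord Y x α m ≠ 0}.Finite :=
  DFinsupp.finite_support (β := fun α => Y.ev (A.o α x)) m

/-- The matrix of P(g) is diagonal with entries αg, so restriction along it does not mix
coordinates. This is why single coordinates are natural over R. -/
theorem pushCoord_canonicalMap (Y : Md.{w} k C) {x y : C} (g : x ⟶ y) (α : G)
    (m : ((pushdown A).obj Y).ev (Orbit.of y)) :
    pushCoord Y x α (((pushdown A).obj Y).res (canonicalMap A g) m) =
      Y.res ((A.act α).map g) (pushCoord Y y α m) := by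
  have h : pushCoord Y x α ∘ₗ pushRes A Y (canonicalMap A g) =
      Y.res ((A.act α).map g) ∘ₗ pushCoord Y y α := by
    apply DirectSum.linearMap_ext
    intro β
    refine LinearMap.ext fun m => ?_
    refine (congrArg (pushCoord Y x α) (pushRes_canonicalMap Y g β m)).trans ?_
    by_cases h : β = α
    · subst h
      exact (pushCoord_lof_self _ _ _ _).trans
        (congrArg (Y.res _) (pushCoord_lof_self _ _ _ _).symm)
    · refine (pushCoord_lof_ne _ _ h _).trans (Eq.symm ?_)
      exact (congrArg (Y.res _) (pushCoord_lof_ne _ _ h _)).trans (map_zero _)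
  exact congr($h m)

theorem pushCoord_app {Y Y' : Md.{w} k C} (v : Y ⟶ Y') (x : C) (α : G)
    (m : ((pushdown A).obj Y).ev (Orbit.of x)) :
    pushCoord Y' x α (app ((pushdown A).map v) (Orbit.of x) m) =
      app v (A.o α x) (pushCoord Y x α m) :=
  DirectSum.lmap_apply (fun α => app v (A.o α x)) m α

/-- The maps `X(α⁻¹x) → Y(x)` given by the `α`-th coordinates of a morphism `P_• X ⟶ P_• Y`. -/
noncomputable def pushCompApp {X Y : Md.{w} k C} (α : G)
    (f : (pushdown A).obj X ⟶ (pushdown A).obj Y) (x : C) : X.ev (A.o α⁻¹ x) →ₗ[k] Y.ev x :=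
  Y.res (eqToHom (A.o_o_inv α x).symm) ∘ₗ
    pushCoord Y (A.o α⁻¹ x) α ∘ₗ pushRestrict f (A.o α⁻¹ x)

theorem pushCompApp_apply {X Y : Md.{w} k C} (α : G)
    (f : (pushdown A).obj X ⟶ (pushdown A).obj Y) (x : C) (m : X.ev (A.o α⁻¹ x)) :
    pushCompApp α f x m = Y.res (eqToHom (A.o_o_inv α x).symm)
      (pushCoord Y (A.o α⁻¹ x) α (pushRestrict f (A.o α⁻¹ x) m)) := rfl

theorem GAction.map_map_inv (α : G) {x y : C} (g : x ⟶ y) :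
    (A.act α).map ((A.act α⁻¹).map g) =
      eqToHom (A.o_o_inv α _) ≫ g ≫ eqToHom (A.o_o_inv α _).symm := by
  have h := A.map_mul α α⁻¹ g
  rw [A.map_eq (mul_inv_cancel α), A.map_one] at h
  rw [← cancel_epi (eqToHom (A.o_mul α α⁻¹ _)),
    ← cancel_mono (eqToHom (A.o_mul α α⁻¹ _).symm)]
  simp only [Category.assoc, eqToHom_trans, eqToHom_trans_assoc] at h ⊢
  exact h.symm

/-- The twist by α⁻¹ on the source is undone by the α-th coordinate, on which P(α⁻¹g) acts through
α(α⁻¹g) = g. -/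
theorem pushCompApp_res {X Y : Md.{w} k C} (α : G)
    (f : (pushdown A).obj X ⟶ (pushdown A).obj Y) {x y : C} (g : x ⟶ y)
    (m : X.ev (A.o α⁻¹ y)) :
    pushCompApp α f x (X.res ((A.act α⁻¹).map g) m) = Y.res g (pushCompApp α f y m) := by
  rw [pushCompApp_apply, pushCompApp_apply, pushRestrict_naturality, pushCoord_canonicalMap,
    ← res_comp, ← res_comp, A.map_map_inv]
  simp

/-- The component `ᵅX ⟶ Y` of a morphism `P_• X ⟶ P_• Y`. -/
noncomputable def pushComp {X Y : Md.{w} k C} (α : G)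
    (f : (pushdown A).obj X ⟶ (pushdown A).obj Y) : ((actMd.{w} A).act α).obj X ⟶ Y :=
  homMk' (pushCompApp α f) (pushCompApp_res α f)

theorem actApp_pushComp {X Y : Md.{w} k C} (α : G)
    (f : (pushdown A).obj X ⟶ (pushdown A).obj Y) (x : C) (m : X.ev (A.o α⁻¹ x)) :
    actApp (pushComp α f) x m = Y.res (eqToHom (A.o_o_inv α x).symm)
      (pushCoord Y (A.o α⁻¹ x) α (pushRestrict f (A.o α⁻¹ x) m)) := rfl

theorem pushRestrict_add {X : Md.{w} k C} {Y : Md.{w} k (Orbit A)}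
    (f g : (pushdown A).obj X ⟶ Y) (x : C) (m : X.ev x) :
    pushRestrict (f + g) x m = pushRestrict f x m + pushRestrict g x m := rfl

theorem pushRestrict_map_comp {X X' : Md.{w} k C} {Y : Md.{w} k (Orbit A)} (u : X ⟶ X')
    (f : (pushdown A).obj X' ⟶ Y) (x : C) (m : X.ev x) :
    pushRestrict ((pushdown A).map u ≫ f) x m = pushRestrict f x (app u x m) := by
  refine congrArg (app f (Orbit.of x)) ?_
  refine (pushApp_lof u (Orbit.of x) 1 _).trans ?_
  rw [app_res]
  rfl

theorem pushComp_add {X Y : Md.{w} k C} (α : G) (f g : (pushdown A).obj X ⟶ (pushdown A).obj Y) :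
    pushComp α (f + g) = pushComp α f + pushComp α g :=
  actApp_ext fun x m => by
    rw [actApp_add, actApp_pushComp, actApp_pushComp, actApp_pushComp, pushRestrict_add,
      map_add, map_add]

/-- `pushComp` as an additive map. -/
noncomputable def pushCompHom (X Y : Md.{w} k C) (α : G) :
    ((pushdown A).obj X ⟶ (pushdown A).obj Y) →+ (((actMd.{w} A).act α).obj X ⟶ Y) :=
  AddMonoidHom.mk' (pushComp α) (pushComp_add α)

/-- With `pushComp_comp_map`, the naturality through which components commute with differentials and
respect homotopies. -/
theorem pushComp_map_comp {X X' Y : Md.{w} k C} (α : G) (u : X ⟶ X')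
    (f : (pushdown A).obj X' ⟶ (pushdown A).obj Y) :
    pushComp α ((pushdown A).map u ≫ f) = ((actMd.{w} A).act α).map u ≫ pushComp α f :=
  actApp_ext fun x m => by
    rw [actApp_map_comp, actApp_pushComp, actApp_pushComp, pushRestrict_map_comp]

theorem pushComp_comp_map {X Y Y' : Md.{w} k C} (α : G) (v : Y ⟶ Y')
    (f : (pushdown A).obj X ⟶ (pushdown A).obj Y) :
    pushComp α (f ≫ (pushdown A).map v) = pushComp α f ≫ v :=
  actApp_ext fun x m => by
    rw [actApp_comp, actApp_pushComp, actApp_pushComp, app_res]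
    exact congrArg (Y'.res _) (pushCoord_app v _ α _)

/-- Restriction along the adjunction starts in the summand 1, which φ_β relabels as β · 1, and
P_•(f) preserves summands. Hence only the coordinate β can be non-zero. -/
theorem pushRestrict_pushAdj {X Y : Md.{w} k C} (β : G) (f : ((actMd.{w} A).act β).obj X ⟶ Y)
    (x : C) (m : X.ev x) :
    pushRestrict ((pushAdj A β).app X ≫ (pushdown A).map f) x m =
      DirectSum.lof k G (fun α => Y.ev (A.o α x)) β
        (actApp f (A.o β x) (X.res (eqToHom (A.o_inv_o β x)) m)) := by
  have h := pushAdjApp_lof β X (Orbit.of x) 1 (X.res (eqToHom (A.o_one x)) m)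
  refine (congrArg (pushApp A f (Orbit.of x)) h).trans ?_
  refine (pushApp_lof f (Orbit.of x) (β * 1) _).trans ?_
  -- Transport the right-hand side from the summand β to β * 1, where the left-hand side lives; it
  -- remains to compare two restrictions of m along identities.
  rw [← lof_eqToHom Y x (mul_one β), ← actApp_res, eqToHom_map]
  refine congrArg (fun m => DirectSum.lof k G (fun α => Y.ev (A.o α x)) (β * 1)
    (actApp f (A.o (β * 1) x) m)) ?_
  rw [← res_comp, eqToHom_trans]
  exact ((X.res_comp _ _ m).symm.trans (congrArg (X.res · m) (eqToHom_trans _ _))).symm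

theorem pushComp_pushAdj_self {X Y : Md.{w} k C} (α : G) (f : ((actMd.{w} A).act α).obj X ⟶ Y) :
    pushComp α ((pushAdj A α).app X ≫ (pushdown A).map f) = f :=
  actApp_ext fun x m => by
    rw [actApp_pushComp, pushRestrict_pushAdj]
    refine (congrArg (Y.res _) (pushCoord_lof_self _ _ _ _)).trans ?_
    rw [← actApp_res, ← res_comp, eqToHom_map, eqToHom_trans, eqToHom_refl, res_id]

theorem pushComp_pushAdj_ne {X Y : Md.{w} k C} {α β : G} (h : β ≠ α)
    (f : ((actMd.{w} A).act β).obj X ⟶ Y) :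
    pushComp α ((pushAdj A β).app X ≫ (pushdown A).map f) = 0 :=
  actApp_ext fun x m => by
    rw [actApp_pushComp, pushRestrict_pushAdj]
    exact (congrArg (Y.res _) (pushCoord_lof_ne _ _ h _)).trans (map_zero _)

theorem pushCoord_pushRestrict_eq_zero {X Y : Md.{w} k C} (α : G)
    (f : (pushdown A).obj X ⟶ (pushdown A).obj Y) (h : pushComp α f = 0) (x : C) (m : X.ev x) :
    pushCoord Y x α (pushRestrict f x m) = 0 := by
  -- The component at z only sees X(α⁻¹z); taking z = αx reaches every object.
  obtain ⟨z, rfl⟩ : ∃ z, x = A.o α⁻¹ z := ⟨A.o α x, (A.o_inv_o α x).symm⟩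
  have h1 : actApp (pushComp α f) z m = 0 := by rw [h]; rfl
  rw [actApp_pushComp] at h1
  have h2 := congrArg (Y.res (eqToHom (A.o_o_inv α z))) h1
  rwa [← res_comp, eqToHom_trans, eqToHom_refl, res_id, map_zero] at h2

/-- A morphism `P_• X ⟶ P_• Y` is determined by its components. -/
theorem eq_zero_of_pushComp {X Y : Md.{w} k C} (f : (pushdown A).obj X ⟶ (pushdown A).obj Y)
    (h : ∀ α, pushComp α f = 0) : f = 0 := by
  -- Under the adjunction f is determined by its restriction to the summand 1, whose values are
  -- elements of a direct sum and can be compared coordinatewise.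
  apply ((pushPullAdj A).homEquiv X ((pushdown A).obj Y)).injective
  apply hom_ext'
  intro x m
  change pushRestrict f x m = pushRestrict 0 x m
  apply pushCoord_ext
  intro α
  rw [pushCoord_pushRestrict_eq_zero α f (h α)]
  exact (map_zero _).symm

/-- A finitely generated module has a finite generating family. -/
theorem Md.FG.exists_generators {X : Md.{t} k C} (hX : X.FG) :
    ∃ (n : ℕ) (x : Fin n → C) (e : ∀ i, X.ev (x i)), ∀ (y : C) (m : X.ev y),
      ∃ g : ∀ i, y ⟶ x i, m = ∑ i, X.res (g i) (e i) := by
  obtain ⟨n, x, p, hp⟩ := hX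
  let b := fun i => rep.{t} (k := k) (x i)
  refine ⟨n, x, fun i => app (biproduct.ι b i ≫ p) (x i) (ULift.up (𝟙 (x i))), fun y m => ?_⟩
  obtain ⟨m, rfl⟩ := surjective_of_epi p y m
  let g : ∀ i, (rep.{t} (k := k) (x i)).ev y := fun i => app (biproduct.π b i) y m
  refine ⟨fun i => (g i).down, ?_⟩
  have h1 : p = ∑ i, biproduct.π b i ≫ biproduct.ι b i ≫ p := by
    conv_lhs => rw [← Category.id_comp p, ← biproduct.total, Preadditive.sum_comp]
    simp only [Category.assoc]
    rfl
  conv_lhs => rw [h1, app_sum]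
  refine Finset.sum_congr rfl fun i _ => ?_
  -- Yoneda: an element of a representable module is the restriction of the identity along itself.
  refine Eq.trans ?_ (app_res (biproduct.ι b i ≫ p) (g i).down (ULift.up (𝟙 (x i))))
  refine congrArg (app (biproduct.ι b i ≫ p) y) ?_
  apply ULift.ext
  exact (Category.comp_id _).symm

/-- A component vanishes once the α-th coordinates of the images of all generators do, since every
element is a sum of restrictions of generators. Each image lies in a direct sum, so only finitely
many α escape. -/
theorem finite_pushComp {X Y : Md.{w} k C} (hX : X.FG)
    (f : (pushdown A).obj X ⟶ (pushdown A).obj Y) : {α | pushComp α f ≠ 0}.Finite := by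
  obtain ⟨n, x, e, he⟩ := hX.exists_generators
  refine (Set.finite_iUnion fun i =>
    finite_pushCoord Y (x i) (pushRestrict f (x i) (e i))).subset fun α hα => ?_
  by_contra h
  simp only [Set.mem_iUnion, Set.mem_ofPred_eq, not_exists, not_not] at h
  refine hα (actApp_ext fun y m => ?_)
  obtain ⟨g, rfl⟩ := he _ m
  rw [actApp_pushComp, map_sum, map_sum, actApp_zero]
  refine (congrArg _ (Finset.sum_eq_zero fun i _ => ?_)).trans (map_zero _)
  rw [pushRestrict_naturality, pushCoord_canonicalMap, h i, map_zero]

/-- A morphism `P_• X ⟶ P_• Y` with finitely many components is their sum. -/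
theorem eq_sum_pushComp {X Y : Md.{w} k C} (f : (pushdown A).obj X ⟶ (pushdown A).obj Y)
    (S : Finset G) (hS : ∀ α, pushComp α f ≠ 0 → α ∈ S) :
    f = ∑ α ∈ S, (pushAdj A α).app X ≫ (pushdown A).map (pushComp α f) := by
  -- The difference of the two sides has all components zero: on the sum, the β-th component picks
  -- out the term α = β, or gives 0 if β ∉ S.
  rw [← sub_eq_zero]
  apply eq_zero_of_pushComp
  intro β
  change pushCompHom X Y β _ = 0
  rw [map_sub, map_sum, sub_eq_zero]
  change pushComp β f = ∑ α ∈ S, pushComp β _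
  by_cases hβ : β ∈ S
  · rw [Finset.sum_eq_single_of_mem β hβ fun α _ h => pushComp_pushAdj_ne h _,
      pushComp_pushAdj_self]
  · rw [Finset.sum_eq_zero fun α hα => pushComp_pushAdj_ne (ne_of_mem_of_not_mem hα hβ) _]
    by_contra h
    exact hβ (hS β h)

end Components

/-! ### Maps out of a direct sum, tested on representatives -/

section DirectSumCriterion

variable {k ι : Type*} [CommRing k] [DecidableEq ι] {M Q : ι → Type*} {N P : Type*}
  [∀ i, AddCommGroup (M i)] [∀ i, Module k (M i)] [AddCommGroup N] [Module k N]
  [∀ i, AddCommGroup (Q i)] [AddCommGroup P]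
  (Φ : DirectSum ι M →ₗ[k] N) (q : ∀ i, Q i →+ M i) (p : P →+ N) (a : ∀ i, Q i → P)

/-- A map out of a direct sum is injective if it has coordinates compatible with presentations of
the summands and of the target. -/
theorem injective_of_coordinates
    (hΦ : ∀ i x, Φ (DirectSum.lof k ι M i (q i x)) = p (a i x))
    (hq : ∀ i, Function.Surjective (q i)) (c : ∀ i, P →+ Q i)
    (c_self : ∀ i x, c i (a i x) = x) (c_ne : ∀ i j, j ≠ i → ∀ x, c i (a j x) = 0)
    (hc : ∀ i y, p y = 0 → q i (c i y) = 0) : Function.Injective Φ := by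
  classical
  rw [injective_iff_map_eq_zero]
  intro v hv
  -- Lift the entries of v to representatives: p then kills the sum of the `a i (f i)` over the
  -- support. The coordinate c_j of this sum is f_j, so `hc` makes its class v_j vanish.
  choose f hf using fun i => hq i (v i)
  have h1 : v = ∑ i ∈ DFinsupp.support v, DirectSum.lof k ι M i (q i (f i)) := by
    simp only [hf]
    exact (DirectSum.sum_support_of v).symm
  rw [h1, map_sum, Finset.sum_congr rfl fun i _ => hΦ i (f i), ← map_sum] at hv
  refine DFinsupp.ext fun j => ?_
  by_contra hj
  have h2 := hc j _ hv
  rw [map_sum, Finset.sum_eq_single_of_mem j (DFinsupp.mem_support_iff.2 hj)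
    fun i _ h => c_ne j i h _, c_self, hf] at h2
  exact hj h2

/-- A map out of a direct sum is surjective if every element of a presentation of the target is a
finite sum of elements coming from the summands. -/
theorem surjective_of_finite_sum
    (hΦ : ∀ i x, Φ (DirectSum.lof k ι M i (q i x)) = p (a i x))
    (hp : Function.Surjective p)
    (h : ∀ y, ∃ (S : Finset ι) (x : ∀ i, Q i), y = ∑ i ∈ S, a i (x i)) :
    Function.Surjective Φ := by
  intro t
  obtain ⟨y, rfl⟩ := hp t
  obtain ⟨S, x, rfl⟩ := h y
  refine ⟨∑ i ∈ S, DirectSum.lof k ι M i (q i (x i)), ?_⟩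
  rw [map_sum, map_sum]
  exact Finset.sum_congr rfl fun i _ => hΦ i (x i)

end DirectSumCriterion

/-! ### The adjuster identities for modules -/

section ModuleAdjuster

open Md
open scoped Classical

variable {k : Type uk} [CommRing k] {G : Type w} [Group G]
  {C : Type u} [Category.{v} C] [Preadditive C] [Linear k C] {A : GAction k G C}

/-- Turns an identity between modules into an identity between objects of R. The functor is left as
a variable so that the equation can be substituted away, which is impossible for `A.act 1⁻¹` itself;
`app_eqToHom_precomp_comp` is stated likewise. -/
theorem app_eqToHom_precomp (T : C ⥤ C) [T.Additive] [T.Linear k] (h : T = 𝟭 C)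
    (X : Md.{t} k C) (e : (precomp T).obj X = X) (x : C) (m : X.ev (T.obj x)) :
    app (eqToHom e) x m = X.res (eqToHom (by rw [h]; rfl)) m := by
  subst h
  exact (X.res_id m).symm

theorem app_eqToHom_precomp_comp (T S U : C ⥤ C) [T.Additive] [T.Linear k] [S.Additive]
    [S.Linear k] [U.Additive] [U.Linear k] (h : T = U ⋙ S) (X : Md.{t} k C)
    (e : (precomp T).obj X = (precomp U).obj ((precomp S).obj X)) (x : C)
    (m : X.ev (T.obj x)) :
    app (eqToHom e) x m = X.res (eqToHom (by rw [h]; rfl) : S.obj (U.obj x) ⟶ T.obj x) m := by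
  subst h
  exact (X.res_id m).symm

/-- Relabelling α as 1 · α changes nothing; only the restrictions along identities need to cancel.
-/
theorem pushAdj_one (X : Md.{w} k C) (e : ((actMd.{w} A).act 1).obj X = X) :
    (pushAdj A 1).app X ≫ (pushdown A).map (eqToHom e) = 𝟙 _ := by
  apply hom_ext'
  intro x m
  have : pushApp A (eqToHom e) x ∘ₗ pushAdjApp A 1 X x = LinearMap.id := by
    apply DirectSum.linearMap_ext
    intro α
    refine LinearMap.ext fun m => ?_
    refine (congrArg (pushApp A (eqToHom e) x) (pushAdjApp_lof 1 X x α m)).trans ?_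
    refine (pushApp_lof (eqToHom e) x (1 * α) _).trans ?_
    refine (congrArg (DirectSum.lof k G (fun α => X.ev (A.o α x.base)) (1 * α))
      ((app_eqToHom_precomp (A.act 1⁻¹) (by rw [inv_one, A.act_one]) X e _ _).trans
        (X.res_comp _ _ m).symm)).trans ?_
    rw [eqToHom_trans]
    exact lof_eqToHom X x.base (one_mul α) m
  exact congr($this m)

/-- One side sends the summand γ to (βα)γ, the other to β(αγ), both by restriction along an identity
of objects. -/
theorem pushAdj_mul (β α : G) (X : Md.{w} k C)
    (e : ((actMd.{w} A).act (β * α)).obj X =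
      ((actMd.{w} A).act β).obj (((actMd.{w} A).act α).obj X)) :
    (pushAdj A (β * α)).app X ≫ (pushdown A).map (eqToHom e) =
      (pushAdj A α).app X ≫ (pushAdj A β).app (((actMd.{w} A).act α).obj X) := by
  apply hom_ext'
  intro x m
  have : pushApp A (eqToHom e) x ∘ₗ pushAdjApp A (β * α) X x =
      pushAdjApp A β (((actMd.{w} A).act α).obj X) x ∘ₗ pushAdjApp A α X x := by
    apply DirectSum.linearMap_ext
    intro γ
    refine LinearMap.ext fun m => ?_
    refine (congrArg (pushApp A (eqToHom e) x) (pushAdjApp_lof (β * α) X x γ m)).trans ?_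
    refine (pushApp_lof (eqToHom e) x (β * α * γ) _).trans ?_
    refine Eq.trans ?_ ((congrArg (pushAdjApp A β (((actMd.{w} A).act α).obj X) x)
      (pushAdjApp_lof α X x γ m)).trans
      (pushAdjApp_lof β (((actMd.{w} A).act α).obj X) x (α * γ) _)).symm
    refine Eq.trans ?_ (lof_eqToHom (((actMd.{w} A).act β).obj (((actMd.{w} A).act α).obj X))
      x.base (mul_assoc β α γ) _)
    refine congrArg (DirectSum.lof k G (fun γ => (((actMd.{w} A).act β).obj
      (((actMd.{w} A).act α).obj X)).ev (A.o γ x.base)) (β * α * γ)) ?_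
    refine (app_eqToHom_precomp_comp (A.act (β * α)⁻¹) (A.act α⁻¹) (A.act β⁻¹)
      (by rw [mul_inv_rev, A.act_mul]) X e _ _).trans ?_
    refine (X.res_comp _ _ m).symm.trans ?_
    refine Eq.trans ?_ ((X.res_comp _ _ _).trans (congrArg _ (X.res_comp _ _ m)))
    refine congrArg (X.res · m) ?_
    simp only [Functor.op_map, Quiver.Hom.unop_op, eqToHom_map, eqToHom_trans]
  exact congr($this m)

end ModuleAdjuster

/-! ### From modules to homotopy categories: the adjuster identities -/

section HomotopyAdjuster

variable {k : Type uk} [CommRing k] {C : Type u} [Category.{v} C] [Preadditive C] [Linear k C]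
  {D : Type u'} [Category.{v'} D] [Preadditive D] [Linear k D]

/-- The morphism of `K^b(prj C)` given by a morphism of complexes. -/
def kbQuot (X Y : Kb.{t} k C) : (X.obj.as ⟶ Y.obj.as) →+ (X ⟶ Y) where
  toFun f := ObjectProperty.homMk ((HomotopyCategory.quotient _ _).map f)
  map_zero' := rfl
  map_add' _ _ := rfl

theorem kbQuot_surjective (X Y : Kb.{t} k C) : Function.Surjective (kbQuot X Y) := by
  rintro ⟨f⟩
  obtain ⟨f, rfl⟩ := (HomotopyCategory.quotient _ _).map_surjective f
  exact ⟨f, rfl⟩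

theorem kbQuot_eq_zero_iff {X Y : Kb.{t} k C} (f : X.obj.as ⟶ Y.obj.as) :
    kbQuot X Y f = 0 ↔ Nonempty (Homotopy f 0) := by
  rw [← HomotopyCategory.quotient_map_eq_zero_iff]
  exact ⟨fun h => congrArg (·.hom) h, fun h => ObjectProperty.hom_ext _ h⟩

variable {P : Md.{t} k C ⥤ Md.{t'} k D} [P.Additive] (hP : PresPrj P)

/-- The morphism of complexes which is `ψ` in every degree. -/
def adjComplex {T : Md.{t} k C ⥤ Md.{t} k C} [T.Additive] (hT : PresPrj T) (ψ : P ⟶ T ⋙ P)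
    (X : HomologicalComplex (Prj.{t} k C) (ComplexShape.up ℤ)) :
    ((prjFunctor P hP).mapHomologicalComplex _).obj X ⟶
      ((prjFunctor P hP).mapHomologicalComplex _).obj
        (((prjFunctor T hT).mapHomologicalComplex _).obj X) where
  f i := ObjectProperty.homMk (ψ.app (X.X i).obj)
  comm' i j _ := ObjectProperty.hom_ext _ (ψ.naturality (X.d i j).hom).symm

/-- The morphism of `K^b(prj D)` which is `ψ` in every degree. -/
def adjKb {T : Md.{t} k C ⥤ Md.{t} k C} [T.Additive] (hT : PresPrj T) (ψ : P ⟶ T ⋙ P)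
    (X : Kb.{t} k C) :
    (kbFunctor P hP).obj X ⟶ (kbFunctor P hP).obj ((kbFunctor T hT).obj X) :=
  ObjectProperty.homMk ((HomotopyCategory.quotient _ _).map (adjComplex hP hT ψ X.obj.as))

theorem adjKb_one (T : Md.{t} k C ⥤ Md.{t} k C) [T.Additive] (hT : PresPrj T) (h : T = 𝟭 _)
    (ψ : P ⟶ T ⋙ P)
    (hψ : ∀ (X : Md.{t} k C) (e : T.obj X = X), ψ.app X ≫ P.map (eqToHom e) = 𝟙 _)
    (X : Kb.{t} k C) (e : (kbFunctor T hT).obj X = X) :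
    adjKb hP hT ψ X ≫ (kbFunctor P hP).map (eqToHom e) = 𝟙 _ := by
  -- Possible because T is a variable here. Afterwards the transport e is an identity morphism, and
  -- the claim reduces to ψ being the identity in every degree.
  subst h
  have hψ' : ∀ X, ψ.app X = 𝟙 _ := fun X => by
    have := hψ X rfl
    rw [eqToHom_refl, P.map_id] at this
    exact (Category.comp_id _).symm.trans this
  have h1 : adjComplex hP hT ψ X.obj.as = 𝟙 _ := by
    ext i : 1
    exact ObjectProperty.hom_ext _ (hψ' _)
  have h2 : adjKb hP hT ψ X = 𝟙 _ := ObjectProperty.hom_ext _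
    ((congrArg (HomotopyCategory.quotient _ _).map h1).trans
      ((HomotopyCategory.quotient _ _).map_id _))
  have h3 : (kbFunctor P hP).map (eqToHom e) = 𝟙 _ := (kbFunctor P hP).map_id X
  refine (congrArg₂ (· ≫ ·) h2 h3).trans (Category.comp_id _)

theorem adjKb_mul (T S U : Md.{t} k C ⥤ Md.{t} k C) [T.Additive] [S.Additive] [U.Additive]
    (hT : PresPrj T) (hS : PresPrj S) (hU : PresPrj U) (h : T = S ⋙ U)
    (ψT : P ⟶ T ⋙ P) (ψS : P ⟶ S ⋙ P) (ψU : P ⟶ U ⋙ P)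
    (hψ : ∀ (X : Md.{t} k C) (e : T.obj X = U.obj (S.obj X)),
      ψT.app X ≫ P.map (eqToHom e) = ψS.app X ≫ ψU.app (S.obj X))
    (X : Kb.{t} k C)
    (e : (kbFunctor T hT).obj X = (kbFunctor U hU).obj ((kbFunctor S hS).obj X)) :
    adjKb hP hT ψT X ≫ (kbFunctor P hP).map (eqToHom e) =
      adjKb hP hS ψS X ≫ adjKb hP hU ψU ((kbFunctor S hS).obj X) := by
  subst h
  have hψ' : ∀ X, ψT.app X = ψS.app X ≫ ψU.app (S.obj X) := fun X => by
    rw [← hψ X rfl, eqToHom_refl, P.map_id]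
    exact (Category.comp_id _).symm
  have h1 : adjComplex hP hT ψT X.obj.as = adjComplex hP hS ψS X.obj.as ≫
      adjComplex hP hU ψU (((prjFunctor S hS).mapHomologicalComplex _).obj X.obj.as) := by
    ext i : 1
    exact ObjectProperty.hom_ext _ (hψ' _)
  have h2 : adjKb hP hT ψT X =
      adjKb hP hS ψS X ≫ adjKb hP hU ψU ((kbFunctor S hS).obj X) := ObjectProperty.hom_ext _
    ((congrArg (HomotopyCategory.quotient _ _).map h1).trans
      ((HomotopyCategory.quotient _ _).map_comp _ _))
  have h3 : (kbFunctor P hP).map (eqToHom e) = 𝟙 _ := (kbFunctor P hP).map_id _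
  exact (congrArg₂ (· ≫ ·) h2 h3).trans (Category.comp_id _)

end HomotopyAdjuster

/-! ### From modules to homotopy categories: components of chain maps and homotopies -/

section HomotopyComponents

variable {k : Type uk} [CommRing k] {C : Type u} [Category.{v} C] [Preadditive C] [Linear k C]
  {D : Type u'} [Category.{v'} D] [Preadditive D] [Linear k D]
  {P : Md.{t} k C ⥤ Md.{t'} k D} (hP : PresPrj P)
  {T : Md.{t} k C ⥤ Md.{t} k C} (hT : PresPrj T)

/-- A natural family of additive maps `Hom(P X, P Y) → Hom(T X, Y)`. -/
structure HomTransfer (P : Md.{t} k C ⥤ Md.{t'} k D) (T : Md.{t} k C ⥤ Md.{t} k C) where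
  toHom : ∀ X Y, (P.obj X ⟶ P.obj Y) →+ (T.obj X ⟶ Y)
  map_comp : ∀ {X X' Y : Md.{t} k C} (u : X ⟶ X') (f : P.obj X' ⟶ P.obj Y),
    toHom X Y (P.map u ≫ f) = T.map u ≫ toHom X' Y f
  comp_map : ∀ {X Y Y' : Md.{t} k C} (f : P.obj X ⟶ P.obj Y) (v : Y ⟶ Y'),
    toHom X Y' (f ≫ P.map v) = toHom X Y f ≫ v

variable (c : HomTransfer P T)

/-- The transfer of morphisms between projective modules. -/
def HomTransfer.prj (X Y : Prj.{t} k C) :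
    ((prjFunctor P hP).obj X ⟶ (prjFunctor P hP).obj Y) →+ ((prjFunctor T hT).obj X ⟶ Y) where
  toFun f := ObjectProperty.homMk (c.toHom X.obj Y.obj f.hom)
  map_zero' := ObjectProperty.hom_ext _ (map_zero (c.toHom X.obj Y.obj))
  map_add' f g := ObjectProperty.hom_ext _ (map_add (c.toHom X.obj Y.obj) f.hom g.hom)

theorem HomTransfer.prj_map_comp {X X' Y : Prj.{t} k C} (u : X ⟶ X')
    (f : (prjFunctor P hP).obj X' ⟶ (prjFunctor P hP).obj Y) :
    c.prj hP hT X Y ((prjFunctor P hP).map u ≫ f) =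
      (prjFunctor T hT).map u ≫ c.prj hP hT X' Y f :=
  ObjectProperty.hom_ext _ (c.map_comp u.hom f.hom)

theorem HomTransfer.prj_comp_map {X Y Y' : Prj.{t} k C}
    (f : (prjFunctor P hP).obj X ⟶ (prjFunctor P hP).obj Y) (v : Y ⟶ Y') :
    c.prj hP hT X Y' (f ≫ (prjFunctor P hP).map v) = c.prj hP hT X Y f ≫ v :=
  ObjectProperty.hom_ext _ (c.comp_map f.hom v.hom)

variable [P.Additive] [T.Additive]

/-- The transfer of morphisms of complexes. -/
def HomTransfer.complex (K L : HomologicalComplex (Prj.{t} k C) (ComplexShape.up ℤ)) :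
    (((prjFunctor P hP).mapHomologicalComplex (ComplexShape.up ℤ)).obj K ⟶
      ((prjFunctor P hP).mapHomologicalComplex (ComplexShape.up ℤ)).obj L) →+
    (((prjFunctor T hT).mapHomologicalComplex (ComplexShape.up ℤ)).obj K ⟶ L) where
  toFun f :=
    { f i := c.prj hP hT (K.X i) (L.X i) (f.f i)
      comm' i j _ := by
        have h := f.comm i j
        simp only [Functor.mapHomologicalComplex_obj_d] at h
        -- Both differentials involved are images of differentials under P, so the two naturality
        -- conditions suffice; c need not respect composition of arbitrary morphisms between objects
        -- P X.
        exact (c.prj_comp_map hP hT _ _).symm.trans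
          ((congrArg (c.prj hP hT (K.X i) (L.X j)) h).trans (c.prj_map_comp hP hT _ _)) }
  map_zero' := by
    ext i : 1
    exact map_zero (c.prj hP hT (K.X i) (L.X i))
  map_add' f g := by
    ext i : 1
    exact map_add (c.prj hP hT (K.X i) (L.X i)) (f.f i) (g.f i)

/-- The transfer of null homotopies. -/
def HomTransfer.homotopy {K L : HomologicalComplex (Prj.{t} k C) (ComplexShape.up ℤ)}
    {f : ((prjFunctor P hP).mapHomologicalComplex (ComplexShape.up ℤ)).obj K ⟶
      ((prjFunctor P hP).mapHomologicalComplex (ComplexShape.up ℤ)).obj L}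
    (h : Homotopy f 0) : Homotopy (c.complex hP hT K L f) 0 where
  hom i j := c.prj hP hT (K.X i) (L.X j) (h.hom i j)
  zero i j hij := by rw [h.zero i j hij]; exact map_zero _
  comm i := by
    let u : (prjFunctor P hP).obj (K.X i) ⟶ (prjFunctor P hP).obj (L.X i) :=
      (prjFunctor P hP).map (K.d i ((ComplexShape.up ℤ).next i)) ≫ h.hom _ i
    let v : (prjFunctor P hP).obj (K.X i) ⟶ (prjFunctor P hP).obj (L.X i) :=
      h.hom i _ ≫ (prjFunctor P hP).map (L.d ((ComplexShape.up ℤ).prev i) i)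
    have h0 : f.f i = u + v := (h.comm i).trans (add_zero _)
    have h1 : c.prj hP hT (K.X i) (L.X i) (f.f i) =
        c.prj hP hT (K.X i) (L.X i) u + c.prj hP hT (K.X i) (L.X i) v :=
      (congrArg (c.prj hP hT (K.X i) (L.X i)) h0).trans (map_add _ u v)
    -- In each of the two terms `u`, `v` of the homotopy formula one factor is P of a differential,
    -- so c passes through it.
    exact h1.trans ((congrArg₂ (· + ·) (c.prj_map_comp hP hT _ _)
      (c.prj_comp_map hP hT _ _)).trans (add_zero _).symm)

end HomotopyComponents

/-! ### The pushdown on bounded complexes of finitely generated projectives -/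

section Main

variable {k : Type uk} [CommRing k] {G : Type w} [Group G]
  {C : Type u} [Category.{v} C] [Preadditive C] [Linear k C] (A : GAction k G C)

theorem pushAdjKb_isInvarianceAdjuster :
    IsInvarianceAdjuster (actKb.{w} A) (pushdownKb A) (pushAdjKb A) :=
  IsInvarianceAdjuster.of_one_mul _ _ _
    (fun X => adjKb_one (pushdown_presPrj A) _ (actMd_presPrj A 1) (actMd.{w} A).act_one
      (pushAdj A 1) pushAdj_one X _)
    (fun β α X => adjKb_mul (pushdown_presPrj A) _ _ _ (actMd_presPrj A (β * α))
      (actMd_presPrj A α) (actMd_presPrj A β) ((actMd.{w} A).act_mul β α)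
      (pushAdj A (β * α)) (pushAdj A α) (pushAdj A β) (pushAdj_mul β α) X _)

variable {A}

/-- The components `Hom(P_• X, P_• Y) → Hom(ᵅX, Y)`. -/
noncomputable def pushTransfer (A : GAction k G C) (α : G) :
    HomTransfer (pushdown A) ((actMd.{w} A).act α) where
  toHom X Y := pushCompHom X Y α
  map_comp := pushComp_map_comp α
  comp_map f v := pushComp_comp_map α v f

variable {X Y : Kb.{w} k C}

/-- The morphism of complexes `φ_α ≫ P_• f`. -/
noncomputable def pushAdjMap (α : G)
    (f : ((actKb.{w} A).o α X).obj.as ⟶ Y.obj.as) :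
    ((pushdownKb A).obj X).obj.as ⟶ ((pushdownKb A).obj Y).obj.as :=
  pushAdjComplex A α X.obj.as ≫
    ((prjFunctor (pushdown A) (pushdown_presPrj A)).mapHomologicalComplex _).map f

/-- The component of a morphism of complexes `P_• X ⟶ P_• Y`. -/
noncomputable def kbComp (α : G) :
    (((pushdownKb A).obj X).obj.as ⟶ ((pushdownKb A).obj Y).obj.as) →+
      (((actKb.{w} A).o α X).obj.as ⟶ Y.obj.as) :=
  (pushTransfer A α).complex (pushdown_presPrj A) (actMd_presPrj A α) X.obj.as Y.obj.as

theorem kbComp_f (α : G) (f : ((pushdownKb A).obj X).obj.as ⟶ ((pushdownKb A).obj Y).obj.as)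
    (i : ℤ) : ((kbComp α f).f i).hom = pushComp α (f.f i).hom := rfl

theorem kbComp_pushAdjMap_self (α : G) (f : ((actKb.{w} A).o α X).obj.as ⟶ Y.obj.as) :
    kbComp α (pushAdjMap α f) = f := by
  ext i : 1
  exact ObjectProperty.hom_ext _ (pushComp_pushAdj_self α (f.f i).hom)

theorem kbComp_pushAdjMap_ne {α β : G} (h : β ≠ α)
    (f : ((actKb.{w} A).o β X).obj.as ⟶ Y.obj.as) :
    kbComp α (pushAdjMap β f) = 0 := by
  ext i : 1
  exact ObjectProperty.hom_ext _ (pushComp_pushAdj_ne h (f.f i).hom)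

/-- The component of a null homotopy is a null homotopy of the component; injectivity rests on this.
-/
theorem kbQuot_kbComp_eq_zero (α : G)
    (f : ((pushdownKb A).obj X).obj.as ⟶ ((pushdownKb A).obj Y).obj.as)
    (h : kbQuot _ _ f = 0) : kbQuot _ _ (kbComp α f) = 0 := by
  rw [kbQuot_eq_zero_iff] at h ⊢
  exact h.map ((pushTransfer A α).homotopy (pushdown_presPrj A) (actMd_presPrj A α))

/-- A non-zero component is non-zero in some degree between the bounds of X, and in each of these
finitely many degrees finite generation leaves finitely many α. -/
theorem finite_kbComp (f : ((pushdownKb A).obj X).obj.as ⟶ ((pushdownKb A).obj Y).obj.as) :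
    {α : G | kbComp α f ≠ 0}.Finite := by
  obtain ⟨hX, a, b, hab⟩ := X.property
  refine ((Finset.Icc a b).finite_toSet.biUnion fun i _ =>
    finite_pushComp (hX i) (f.f i).hom).subset fun α hα => ?_
  by_contra h
  simp only [Set.mem_iUnion, not_exists, Set.mem_ofPred_eq, not_not, Finset.mem_coe,
    Finset.mem_Icc] at h
  refine hα ?_
  ext i : 1
  by_cases hi : a ≤ i ∧ i ≤ b
  · exact ObjectProperty.hom_ext _ (h i hi)
  -- Outside the bounds the source ᵅXⁱ is zero.
  · exact ((prjFunctor ((actMd.{w} A).act α) (actMd_presPrj A α)).map_isZero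
      (hab i (by omega))).eq_of_src _ _

theorem eq_sum_kbComp (f : ((pushdownKb A).obj X).obj.as ⟶ ((pushdownKb A).obj Y).obj.as)
    (S : Finset G) (hS : ∀ α, kbComp α f ≠ 0 → α ∈ S) :
    f = ∑ α ∈ S, pushAdjMap α (kbComp α f) := by
  ext i : 1
  -- The same S serves every degree: a component that is non-zero in degree i is non-zero as a chain
  -- map.
  have h := eq_sum_pushComp (f.f i).hom S fun α hα => hS α fun h0 => hα <|
    (kbComp_f α f i).symm.trans (congrArg (fun g => (g.f i).hom) h0)
  refine ObjectProperty.hom_ext _ (h.trans (Eq.symm ?_))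
  exact map_sum ((ObjectProperty.ι _).mapAddHom.comp
    (HomologicalComplex.Hom.fAddMonoidHom (C₁ := ((pushdownKb A).obj X).obj.as)
      (C₂ := ((pushdownKb A).obj Y).obj.as) i)) _ _

-- Composition of homotopy classes is computed on representatives, so on each summand the map lifts
-- to chain maps.
open scoped Classical in
theorem precoveringMap_lof (α : G) (f : ((actKb.{w} A).o α X).obj.as ⟶ Y.obj.as) :
    precoveringMap (actKb.{w} A) (pushdownKb A) (pushAdjKb A) X Y
      (DirectSum.lof k G (fun α => ((actKb.{w} A).o α X ⟶ Y)) α (kbQuot _ _ f)) =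
    kbQuot _ _ (pushAdjMap α f) := by
  rw [precoveringMap, DirectSum.toModule_lof]
  rfl

-- The presentations are the quotient maps from chain maps to homotopy classes, and the coordinates
-- are the components `kbComp`.
open scoped Classical in
theorem precoveringMap_injective : Function.Injective
    (precoveringMap (actKb.{w} A) (pushdownKb A) (pushAdjKb A) X Y) :=
  injective_of_coordinates _ _ _ _ precoveringMap_lof (fun _ => kbQuot_surjective _ _) kbComp
    kbComp_pushAdjMap_self (fun _ _ h => kbComp_pushAdjMap_ne h) kbQuot_kbComp_eq_zero

open scoped Classical in
theorem precoveringMap_surjective : Function.Surjective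
    (precoveringMap (actKb.{w} A) (pushdownKb A) (pushAdjKb A) X Y) :=
  surjective_of_finite_sum _ _ _ _ precoveringMap_lof (kbQuot_surjective _ _) fun f =>
    ⟨(finite_kbComp f).toFinset, fun α => kbComp α f,
      eq_sum_kbComp f _ fun _ h => (finite_kbComp f).mem_toFinset.2 h⟩

end Main

end Covering

theorem mainTheorem5 {k : Type uk} [CommRing k] {G : Type w} [Group G]
    {R : Type u} [CategoryTheory.Category.{v} R] [CategoryTheory.Preadditive R]
    [CategoryTheory.Linear k R] (A : Covering.GAction k G R) :
    Covering.IsGPrecovering (Covering.actKb.{w} A) (Covering.pushdownKb A)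
      (Covering.pushAdjKb A) where
  adjuster := Covering.pushAdjKb_isInvarianceAdjuster A
  bijective _ _ := ⟨Covering.precoveringMap_injective, Covering.precoveringMap_surjective⟩
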